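/- **Setting.** Let $m,n\ge 1$ and let $A\in[-1,1]^{m\times n}$ be a boosting matrix. For $\ell:\mathbb R\to\mathbb R$ and $z\in\mathbb R$ let $C_\ell(z)\in[1,\infty]$ be the smallest constant with $C_\ell(z)^{-1}\le e^{x}/\ell^{(i)}(x)\le C_\ell(z)$ for all $x\le z$ and $i\in\{0,1,2\}$. Let $\mathbb L$ be the class of all $\ell:\mathbb R\to[0,\infty)$ that are twice continuously differentiable and strictly convex with $C_\ell(z)<\infty$ for every $z\in\mathbb R$. For $\ell\in\mathbb L$ put $\mathcal L(z)=\frac1m\sum_{i=1}^m\ell(z_i)$ for $z\in\mathbb R^m$ and $\bar{\mathcal L}_A=\inf_{\lambda\in\mathbb R^n}\mathcal L(A\lambda)$. *Algorithm.* Start from $\lambda_0=0$. For $t=1,2,\dots$ choose a column $j_t\in\arg\max_j|\nabla\mathcal L(A\lambda_{t-1})^\top A e_j|$ (ties are broken arbitrarily) and a direction $v_t\in\{\pm e_{j_t}\}$ with $\nabla\mathcal L(A\lambda_{t-1})^\top Av_t=-\|A^\top\nabla\mathcal L(A\lambda_{t-1})\|_\infty$, and set $\lambda_t=\lambda_{t-1}+\alpha_tv_t$.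 Put $\gamma_t=\|A^\top\nabla\mathcal L(A\lambda_{t-1})\|_\infty/\|\nabla\mathcal L(A\lambda_{t-1})\|_1$ and $C_t=C_\ell(\ell^{-1}(m\mathcal L(A\lambda_{t-1})))$, and let $\nu\in(0,1]$ be a shrinkage parameter. The step sizes follow one of these rules, the same one for all $t$: * quadratic upper bound: $\alpha_t=\nu\gamma_t/C_t^4$; * Wolfe: $\alpha_t$ is any number $\alpha$ with $\mathcal L(A(\lambda_{t-1}+\alpha v_t))\le\mathcal L(A\lambda_{t-1})-\alpha(1-\nu/2)\|A^\top\nabla\mathcal L(A\lambda_{t-1})\|_\infty$ and $\nabla\mathcal L(A(\lambda_{t-1}+\alpha v_t))^\top Av_t\ge-(1-\nu/4)\|A^\top\nabla\mathcal L(A\lambda_{t-1})\|_\infty$; * optimal: $\alpha_t=\nu\alpha$, where $\alpha$ is a minimizer (assumed to exist) of $\alpha\mapsto\mathcal L(A(\lambda_{t-1}+\alpha v_t))$ over $\mathbb R$; * AdaBoost, only for $\ell=\exp$ and $A\in\{-1,+1\}^{m\times n}$: $\alpha_t=\frac\nu2\ln\frac{1+\gamma_t}{1-\gamma_t}$, where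 $\gamma_t<1$ is assumed. *Structure of the instance.* Let $\gamma=\max_{\|\lambda\|_1=1}\min_{i\in[m]}-e_i^\top A\lambda$; the instance is separable if $\gamma>0$. A set $H\subseteq[m]$ is a hard core for $A$ if (i) some $\hat\lambda\in\mathbb R^n$ has $e_i^\top A\hat\lambda<0$ for $i\notin H$ and $e_i^\top A\hat\lambda=0$ for $i\in H$, and (ii) every $\lambda\in\mathbb R^n$ with $e_i^\top A\lambda<0$ for some $i\in H$ has $e_k^\top A\lambda>0$ for some $k\in H$. **Theorem.** Let $A\in[-1,1]^{m\times n}$ (possibly not separable), $\nu\in(0,1]$ and $\ell\in\mathbb L$. 1. There is a constant $K>0$, depending only on $A$, $\ell$ and $\nu$, such that for every sequence $(\lambda_t)_{t\ge0}$ of iterates produced with any of the above step size rules (AdaBoost only with $\ell=\exp$ and binary $A$) and every $\epsilon>0$, $$\mathcal L(A\lambda_t)-\bar{\mathcal L}_A\le\epsilon\qquad\text{for all integers } t\ge K\cdot\tfrac1\epsilon .$$ That is, $O(1/\epsilon)$ iterations suffice to reach suboptimality $\epsilon$. 2. If the instance is separable ($\gamma>0$), or $\lambda\mapsto\mathcal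 L(A\lambda)$ attains its infimum, or $A$ has a hard core with $m$ elements, then there is a constant $K>0$, depending only on $A$, $\ell$ and $\nu$, such that for all such sequences and every $\epsilon>0$, $$\mathcal L(A\lambda_t)-\bar{\mathcal L}_A\le\epsilon\qquad\text{for all integers } t\ge K\max\{1,\ln\tfrac1\epsilon\}.$$ That is, $O(\ln(1/\epsilon))$ iterations suffice. -/

import Mathlib

open scoped Matrix NNReal ENNReal

noncomputable section

namespace Boosting

/-- `c` is a valid constant for the loss `ℓ` on `(-∞, z]`: the ratios of `exp` to `ℓ`, `ℓ'`, `ℓ''`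
lie in `[1 / c, c]` there. (If a derivative vanishes at some `x ≤ z`, the ratio is `0` in Lean, so
that no `c` is valid.) -/
def IsLossBound (ℓ : ℝ → ℝ) (z : ℝ) (c : ℝ≥0) : Prop :=
  1 ≤ c ∧ ∀ x ≤ z, ∀ i ∈ ({0, 1, 2} : Finset ℕ),
    (c : ℝ)⁻¹ ≤ Real.exp x / iteratedDeriv i ℓ x ∧ Real.exp x / iteratedDeriv i ℓ x ≤ c

/-- The tightest constant `C_ℓ(z) ∈ [1, ∞]`; it is `∞` if there is no valid constant. -/
def lossConst (ℓ : ℝ → ℝ) (z : ℝ) : ℝ≥0∞ :=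
  ⨅ (c : ℝ≥0) (_ : IsLossBound ℓ z c), (c : ℝ≥0∞)

/-- The class `𝕃` of losses. -/
structure LossClass (ℓ : ℝ → ℝ) : Prop where
  nonneg : ∀ x, 0 ≤ ℓ x
  contDiff : ContDiff ℝ 2 ℓ
  strictConvex : StrictConvexOn ℝ Set.univ ℓ
  lossConst_lt_top : ∀ z, lossConst ℓ z < ⊤

variable {m n : ℕ}

/-- The empirical risk `𝓛(z) = (1/m) ∑ i, ℓ (z i)`. -/
def risk (ℓ : ℝ → ℝ) (z : Fin m → ℝ) : ℝ :=
  (m : ℝ)⁻¹ * ∑ i, ℓ (z i)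

/-- The gradient `∇𝓛(z)`, as the vector of partial derivatives. -/
def riskGrad (ℓ : ℝ → ℝ) (z : Fin m → ℝ) : Fin m → ℝ :=
  fun i => fderiv ℝ (risk ℓ) z (Pi.single i 1)

/-- The optimal value `inf_x 𝓛(A x)`. -/
def optRisk (A : Matrix (Fin m) (Fin n) ℝ) (ℓ : ℝ → ℝ) : ℝ :=
  ⨅ x : Fin n → ℝ, risk ℓ (A *ᵥ x)

/-- The `ℓ¹` norm. -/
def l1norm {k : ℕ} (x : Fin k → ℝ) : ℝ := ∑ i, |x i|

/-- The minimum `ℓ¹` margin of the weighting `x` over the sample. -/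
def margin (A : Matrix (Fin m) (Fin n) ℝ) (x : Fin n → ℝ) : ℝ :=
  ⨅ i : Fin m, -(A *ᵥ x) i / l1norm x

/-- The best margin `γ` over weightings of unit `ℓ¹` norm. -/
def bestMargin (A : Matrix (Fin m) (Fin n) ℝ) : ℝ :=
  sSup (margin A '' {x : Fin n → ℝ | l1norm x = 1})

/-- `H` is a hard core for `A`. -/
def IsHardCore (A : Matrix (Fin m) (Fin n) ℝ) (H : Finset (Fin m)) : Prop :=
  (∃ x : Fin n → ℝ, (∀ i ∉ H, (A *ᵥ x) i < 0) ∧ ∀ i ∈ H, (A *ᵥ x) i = 0) ∧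
    ∀ x : Fin n → ℝ, (∃ i ∈ H, (A *ᵥ x) i < 0) → ∃ k ∈ H, 0 < (A *ᵥ x) k

/-- `Aᵀ ∇𝓛(A x)`. Its sup norm is `‖colGrad A ℓ x‖`, since `Fin n → ℝ` carries the sup norm. -/
def colGrad (A : Matrix (Fin m) (Fin n) ℝ) (ℓ : ℝ → ℝ) (x : Fin n → ℝ) : Fin n → ℝ :=
  Aᵀ *ᵥ riskGrad ℓ (A *ᵥ x)

/-- `γ_t` for the step that starts from `x`. -/
def stepGamma (A : Matrix (Fin m) (Fin n) ℝ) (ℓ : ℝ → ℝ) (x : Fin n → ℝ) : ℝ :=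
  ‖colGrad A ℓ x‖ / l1norm (riskGrad ℓ (A *ᵥ x))

/-- `C_t = C_ℓ(ℓ⁻¹(m 𝓛(A x)))` for the step that starts from `x`. A loss of the class `𝕃` is a
bijection from `ℝ` onto the positive reals, so `Function.invFun` is its inverse there. -/
def stepConst (A : Matrix (Fin m) (Fin n) ℝ) (ℓ : ℝ → ℝ) (x : Fin n → ℝ) : ℝ :=
  (lossConst ℓ (Function.invFun ℓ (m * risk ℓ (A *ᵥ x)))).toReal

/-- The four step size rules. -/
inductive StepRule
  | quadUpper
  | wolfe
  | adaBoost
  | optimal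

/-- `α` is a step size allowed by the rule with shrinkage `ν`, at `x` in direction `v`. -/
def IsStepSize (A : Matrix (Fin m) (Fin n) ℝ) (ℓ : ℝ → ℝ) (ν : ℝ) (x v : Fin n → ℝ) (α : ℝ) :
    StepRule → Prop
  | .quadUpper => α = ν * stepGamma A ℓ x / stepConst A ℓ x ^ 4
  | .wolfe =>
      risk ℓ (A *ᵥ (x + α • v)) ≤ risk ℓ (A *ᵥ x) - α * (1 - ν / 2) * ‖colGrad A ℓ x‖ ∧
      riskGrad ℓ (A *ᵥ (x + α • v)) ⬝ᵥ (A *ᵥ v) ≥ -(1 - ν / 4) * ‖colGrad A ℓ x‖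
  | .adaBoost =>
      -- the case `γ_t = 1`, where the formula is meaningless, is excluded
      stepGamma A ℓ x < 1 ∧
      α = ν / 2 * Real.log ((1 + stepGamma A ℓ x) / (1 - stepGamma A ℓ x))
  | .optimal =>
      ∃ α₁ : ℝ, IsMinOn (fun β : ℝ => risk ℓ (A *ᵥ (x + β • v))) Set.univ α₁ ∧ α = ν * α₁

/-- `v` is a signed coordinate vector of a column that maximises `|∇𝓛(A x)ᵀ A e_j|`, signed such
that `∇𝓛(A x)ᵀ A v = -‖∇𝓛(A x)ᵀ A‖_∞`. -/
def IsDirection (A : Matrix (Fin m) (Fin n) ℝ) (ℓ : ℝ → ℝ) (x v : Fin n → ℝ) : Prop :=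
  ∃ j : Fin n, (∀ k, |colGrad A ℓ x k| ≤ |colGrad A ℓ x j|) ∧
    (v = Pi.single j 1 ∨ v = -Pi.single j 1) ∧
    riskGrad ℓ (A *ᵥ x) ⬝ᵥ (A *ᵥ v) = -‖colGrad A ℓ x‖

/-- `x 0, x 1, …` is a sequence of iterates of the boosting algorithm, with arbitrary tie-breaking,
directions `v` and step sizes `α` consistent with the given rule. The step from `x t` to
`x (t + 1)` is the step number `t + 1` of the algorithm. -/
structure IsBoostRun (A : Matrix (Fin m) (Fin n) ℝ) (ℓ : ℝ → ℝ) (ν : ℝ) (rule : StepRule)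
    (x v : ℕ → Fin n → ℝ) (α : ℕ → ℝ) : Prop where
  init : x 0 = 0
  direction : ∀ t, IsDirection A ℓ (x t) (v t)
  stepSize : ∀ t, IsStepSize A ℓ ν (x t) (v t) (α t) rule
  update : ∀ t, x (t + 1) = x t + α t • v t

end Boosting

end

/-! Below any fixed level, `ℓ`, `ℓ'` and `ℓ''` agree with `exp` up to a factor. On the initial
sublevel set the ℓ¹ norm of `∇𝓛` is therefore comparable to the risk, and the curvature of the risk
along a signed column is at most a multiple of it. A quadratic upper bound then shows that each step
rule lowers the risk `f` by at least `c G² / f`, where `G` is the sup norm of `Aᵀ∇𝓛`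
(`sufficient_decrease`, `exists_run_decrease`). What remains is to bound the suboptimality `δ` by
`G`.

Every matrix has a hard core `H`. On `H`, predictions in a sublevel set stay bounded, because
capping them from above also caps them from below (`IsHardCore.exists_abs_bound`). Off `H`, one
weighting `u` pushes all predictions down without moving those in `H`. Convexity on `H` and the
direction `u` off `H` together give `δ ≤ W G` (`exists_sub_optRisk_le`). Since `f` is bounded, `δ`
drops by a multiple of `δ²` per step, which is the rate `1/ε`.

In the special cases `δ f` is at most a multiple of `G²`, so `δ` contracts geometrically. A positive
margin makes `H` empty, and `u` alone gives `f ≤ W G`. An attained infimum forces `H` to contain all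
rows; predictions are then bounded, the loss is strongly convex on their range, and `δ ≤ W G²`. -/

namespace Boosting

/-! ### Losses comparable to the exponential -/

section Loss

variable {ℓ : ℝ → ℝ}

/-- On `(-∞, z]` the functions `ℓ`, `ℓ'`, `ℓ''` are positive and within a factor `c` of `exp`. -/
def ExpLike (ℓ : ℝ → ℝ) (z c : ℝ) : Prop :=
  1 ≤ c ∧ ∀ x ≤ z, ∀ i ∈ ({0, 1, 2} : Finset ℕ), 0 < iteratedDeriv i ℓ x ∧
    iteratedDeriv i ℓ x ≤ c * Real.exp x ∧ Real.exp x ≤ c * iteratedDeriv i ℓ x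

theorem IsLossBound.expLike {z : ℝ} {c : ℝ≥0} (h : IsLossBound ℓ z c) : ExpLike ℓ z c := by
  have hc : (1 : ℝ) ≤ c := by exact_mod_cast h.1
  refine ⟨hc, fun x hx i hi => ?_⟩
  obtain ⟨h1, h2⟩ := h.2 x hx i hi
  have hr : 0 < Real.exp x / iteratedDeriv i ℓ x := lt_of_lt_of_le (by positivity) h1
  have hd : 0 < iteratedDeriv i ℓ x := by
    by_contra hneg
    exact absurd hr (not_lt.2 (div_nonpos_of_nonneg_of_nonpos (Real.exp_pos x).le (not_lt.1 hneg)))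
  refine ⟨hd, ?_, (div_le_iff₀ hd).1 h2⟩
  rw [le_div_iff₀ hd, inv_mul_le_iff₀ (by linarith)] at h1
  exact h1

theorem lossConst_le {z : ℝ} {c : ℝ≥0} (h : IsLossBound ℓ z c) : lossConst ℓ z ≤ c :=
  iInf₂_le c h

theorem lossConst_mono {y z : ℝ} (h : y ≤ z) : lossConst ℓ y ≤ lossConst ℓ z :=
  le_iInf₂ fun _ hc => lossConst_le ⟨hc.1, fun x hx => hc.2 x (hx.trans h)⟩

/-- Finiteness of the infimum lets lower bounds pass from the admissible constants to its real
value. -/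
theorem le_toReal_lossConst (hℓ : LossClass ℓ) {z a : ℝ}
    (h : ∀ c : ℝ≥0, IsLossBound ℓ z c → a ≤ c) : a ≤ (lossConst ℓ z).toReal := by
  rw [← ENNReal.ofReal_le_iff_le_toReal (hℓ.lossConst_lt_top z).ne]
  refine le_iInf₂ fun c hc => ?_
  rw [← ENNReal.ofReal_coe_nnreal]
  exact ENNReal.ofReal_le_ofReal (h c hc)

/-- The infimum defining `lossConst` is attained. -/
theorem LossClass.isLossBound (hℓ : LossClass ℓ) (z : ℝ) :
    IsLossBound ℓ z (lossConst ℓ z).toNNReal := by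
  refine ⟨?_, fun x hx i hi => ?_⟩
  · rw [← NNReal.coe_le_coe]
    exact le_toReal_lossConst hℓ fun c hc => by exact_mod_cast hc.1
  · have h1 : Real.exp x / iteratedDeriv i ℓ x ≤ (lossConst ℓ z).toReal :=
      le_toReal_lossConst hℓ fun c hc => (hc.2 x hx i hi).2
    have hpos : 0 < Real.exp x / iteratedDeriv i ℓ x := by
      obtain ⟨c, hc⟩ : ∃ c : ℝ≥0, IsLossBound ℓ z c := by
        have := hℓ.lossConst_lt_top z
        simp only [lossConst, iInf_lt_iff] at this
        exact ⟨_, this.choose_spec.choose⟩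
      exact div_pos (Real.exp_pos x) (hc.expLike.2 x hx i hi).1
    refine ⟨?_, h1⟩
    -- Inverting turns the lower bound on the ratio into a lower bound on every admissible `c`.
    change (lossConst ℓ z).toReal⁻¹ ≤ _
    rw [inv_le_comm₀ (lt_of_lt_of_le hpos h1) hpos]
    refine le_toReal_lossConst hℓ fun c hc => ?_
    have hc1 : (1 : ℝ) ≤ c := by exact_mod_cast hc.1
    rw [inv_le_comm₀ hpos (by linarith)]
    exact (hc.2 x hx i hi).1

theorem LossClass.expLike (hℓ : LossClass ℓ) (z : ℝ) : ExpLike ℓ z (lossConst ℓ z).toReal :=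
  (hℓ.isLossBound z).expLike

theorem LossClass.pos (hℓ : LossClass ℓ) (x : ℝ) : 0 < ℓ x := by
  simpa using ((hℓ.expLike x).2 x le_rfl 0 (by simp)).1

theorem LossClass.deriv_pos (hℓ : LossClass ℓ) (x : ℝ) : 0 < deriv ℓ x := by
  simpa using ((hℓ.expLike x).2 x le_rfl 1 (by simp)).1

theorem iteratedDeriv_two (f : ℝ → ℝ) : iteratedDeriv 2 f = deriv (deriv f) := by
  rw [iteratedDeriv_succ, iteratedDeriv_one]

theorem LossClass.deriv2_pos (hℓ : LossClass ℓ) (x : ℝ) : 0 < deriv (deriv ℓ) x := by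
  simpa [iteratedDeriv_two] using ((hℓ.expLike x).2 x le_rfl 2 (by simp)).1

theorem LossClass.hasDerivAt (hℓ : LossClass ℓ) (x : ℝ) : HasDerivAt ℓ (deriv ℓ x) x :=
  ((hℓ.contDiff.differentiable (by norm_num)) x).hasDerivAt

theorem LossClass.contDiff_deriv (hℓ : LossClass ℓ) : ContDiff ℝ 1 (deriv ℓ) :=
  ((contDiff_succ_iff_deriv (n := 1)).1 hℓ.contDiff).2.2

theorem LossClass.hasDerivAt_deriv (hℓ : LossClass ℓ) (x : ℝ) :
    HasDerivAt (deriv ℓ) (deriv (deriv ℓ) x) x :=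
  ((hℓ.contDiff_deriv.differentiable (by norm_num)) x).hasDerivAt

theorem LossClass.strictMono (hℓ : LossClass ℓ) : StrictMono ℓ :=
  strictMono_of_deriv_pos hℓ.deriv_pos

/-- The comparison passes through `exp` and costs one factor `C` each way, hence the square. -/
theorem LossClass.deriv_le (hℓ : LossClass ℓ) {x z : ℝ} (h : x ≤ z) :
    deriv ℓ x ≤ (lossConst ℓ z).toReal ^ 2 * ℓ x := by
  obtain ⟨hc, hE⟩ := hℓ.expLike z
  have h0 := (hE x h 0 (by simp)).2.2
  have h1 := (hE x h 1 (by simp)).2.1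
  rw [iteratedDeriv_zero] at h0
  rw [iteratedDeriv_one] at h1
  nlinarith

theorem LossClass.le_deriv (hℓ : LossClass ℓ) {x z : ℝ} (h : x ≤ z) :
    ℓ x ≤ (lossConst ℓ z).toReal ^ 2 * deriv ℓ x := by
  obtain ⟨hc, hE⟩ := hℓ.expLike z
  have h0 := (hE x h 0 (by simp)).2.1
  have h1 := (hE x h 1 (by simp)).2.2
  rw [iteratedDeriv_zero] at h0
  rw [iteratedDeriv_one] at h1
  nlinarith

theorem LossClass.deriv2_le (hℓ : LossClass ℓ) {x z : ℝ} (h : x ≤ z) :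
    deriv (deriv ℓ) x ≤ (lossConst ℓ z).toReal ^ 2 * ℓ x := by
  obtain ⟨hc, hE⟩ := hℓ.expLike z
  have h0 := (hE x h 0 (by simp)).2.2
  have h1 := (hE x h 2 (by simp)).2.1
  rw [iteratedDeriv_zero] at h0
  rw [iteratedDeriv_two] at h1
  nlinarith

theorem LossClass.add_mul_le (hℓ : LossClass ℓ) (x y : ℝ) :
    ℓ x + deriv ℓ x * (y - x) ≤ ℓ y := by
  rcases lt_trichotomy x y with h | h | h
  · have := hℓ.strictConvex.convexOn.le_slope_of_hasDerivAt (Set.mem_univ x) (Set.mem_univ y) h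
      (hℓ.hasDerivAt x)
    rw [slope_def_field, le_div_iff₀ (by linarith)] at this
    linarith
  · simp [h]
  · have := hℓ.strictConvex.convexOn.slope_le_of_hasDerivAt (Set.mem_univ y) (Set.mem_univ x) h
      (hℓ.hasDerivAt x)
    rw [slope_def_field, div_le_iff₀ (by linarith)] at this
    linarith

theorem LossClass.exists_lt (hℓ : LossClass ℓ) {ε : ℝ} (hε : 0 < ε) : ∃ x, ℓ x < ε := by
  obtain ⟨hc, hE⟩ := hℓ.expLike 0
  set c := (lossConst ℓ 0).toReal
  refine ⟨min 0 (Real.log (ε / (2 * c))), ?_⟩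
  have h0 := (hE _ (min_le_left 0 (Real.log (ε / (2 * c)))) 0 (by simp)).2.1
  rw [iteratedDeriv_zero] at h0
  have h1 : Real.exp (min 0 (Real.log (ε / (2 * c)))) ≤ ε / (2 * c) := by
    rw [← Real.exp_log (show 0 < ε / (2 * c) by positivity)]
    exact Real.exp_le_exp.2 (by simp)
  calc _ ≤ c * (ε / (2 * c)) := h0.trans (by gcongr)
    _ = ε / 2 := by field_simp
    _ < ε := by linarith

theorem LossClass.mem_range (hℓ : LossClass ℓ) {y : ℝ} (hy : 0 < y) : y ∈ Set.range ℓ := by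
  obtain ⟨a, ha⟩ := hℓ.exists_lt hy
  -- The tangent at `0` has height at least `y` at `y / ℓ'(0)`, because `ℓ 0 ≥ 0`.
  refine mem_range_of_exists_le_of_exists_ge hℓ.contDiff.continuous ⟨a, ha.le⟩
    ⟨y / deriv ℓ 0, ?_⟩
  have h1 := hℓ.add_mul_le 0 (y / deriv ℓ 0)
  have h2 := hℓ.nonneg 0
  rw [sub_zero, mul_div_cancel₀ _ (hℓ.deriv_pos 0).ne'] at h1
  linarith

theorem LossClass.apply_invFun (hℓ : LossClass ℓ) {y : ℝ} (hy : 0 < y) :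
    ℓ (Function.invFun ℓ y) = y :=
  Function.invFun_eq (hℓ.mem_range hy)

theorem LossClass.le_invFun (hℓ : LossClass ℓ) {x y : ℝ} (h : ℓ x ≤ y) :
    x ≤ Function.invFun ℓ y := by
  rw [← hℓ.strictMono.le_iff_le, hℓ.apply_invFun ((hℓ.pos x).trans_le h)]
  exact h

end Loss

/-! ### Quadratic upper bounds in one variable -/

section OneDim

/-- A differentiable function whose derivative grows at most at rate `M` on `[0, b]`. -/
theorem le_quadratic_of_deriv2_le {φ φ' φ'' : ℝ → ℝ} {M b : ℝ}
    (h1 : ∀ a, HasDerivAt φ (φ' a) a) (h2 : ∀ a, HasDerivAt φ' (φ'' a) a) (hb : 0 ≤ b)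
    (hM : ∀ a, 0 ≤ a → a ≤ b → φ'' a ≤ M) :
    φ' b ≤ φ' 0 + M * b ∧ φ b ≤ φ 0 + φ' 0 * b + M / 2 * b ^ 2 := by
  have key : ∀ a, 0 ≤ a → a ≤ b → φ' a ≤ φ' 0 + M * a := by
    have hanti : AntitoneOn (fun a => φ' a - M * a) (Set.Icc 0 b) := by
      have hd : ∀ a, HasDerivAt (fun a => φ' a - M * a) (φ'' a - M) a := fun a =>
        ((h2 a).sub ((hasDerivAt_id a).const_mul M)).congr_deriv (by simp)
      refine antitoneOn_of_deriv_nonpos (convex_Icc 0 b)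
        (fun a _ => (hd a).continuousAt.continuousWithinAt)
        (fun a _ => (hd a).differentiableAt.differentiableWithinAt) fun a ha => ?_
      rw [interior_Icc] at ha
      rw [(hd a).deriv]
      linarith [hM a ha.1.le ha.2.le]
    intro a ha0 hab
    have := hanti ⟨le_rfl, hb⟩ ⟨ha0, hab⟩ ha0
    simp only [mul_zero, sub_zero] at this
    linarith
  refine ⟨key b hb le_rfl, ?_⟩
  have hanti : AntitoneOn (fun a => φ a - φ' 0 * a - M / 2 * a ^ 2) (Set.Icc 0 b) := by
    have hd : ∀ a, HasDerivAt (fun a => φ a - φ' 0 * a - M / 2 * a ^ 2)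
        (φ' a - φ' 0 - M * a) a := fun a =>
      (((h1 a).sub ((hasDerivAt_id a).const_mul (φ' 0))).sub
        ((hasDerivAt_pow 2 a).const_mul (M / 2))).congr_deriv (by norm_num; ring)
    refine antitoneOn_of_deriv_nonpos (convex_Icc 0 b)
      (fun a _ => (hd a).continuousAt.continuousWithinAt)
      (fun a _ => (hd a).differentiableAt.differentiableWithinAt) fun a ha => ?_
    rw [interior_Icc] at ha
    rw [(hd a).deriv]
    linarith [key a ha.1.le ha.2.le]
  have := hanti ⟨le_rfl, hb⟩ ⟨hb, le_rfl⟩ hb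
  simp only [mul_zero, sub_zero] at this
  norm_num at this
  linarith

theorem le_of_convexOn_of_le {φ : ℝ → ℝ} (hφ : ConvexOn ℝ Set.univ φ) {a b : ℝ}
    (ha : 0 ≤ a) (hab : a ≤ b) (hb : φ b ≤ φ 0) : φ a ≤ φ 0 :=
  (hφ.le_max_of_mem_Icc (Set.mem_univ 0) (Set.mem_univ b) ⟨ha, hab⟩).trans (by simp [hb])

/-- If `φ'' ≤ M` on the part of `[0, ∞)` where `φ ≤ φ 0`, then the quadratic upper bound holds up
to its minimizer. -/
theorem le_quadratic_of_sublevel {φ φ' φ'' : ℝ → ℝ} {M b : ℝ}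
    (h1 : ∀ a, HasDerivAt φ (φ' a) a) (h2 : ∀ a, HasDerivAt φ' (φ'' a) a)
    (hφ : ConvexOn ℝ Set.univ φ) (hM0 : 0 < M)
    (hM : ∀ a, 0 ≤ a → φ a ≤ φ 0 → φ'' a ≤ M) (hb : 0 ≤ b) (hbM : M * b ≤ -φ' 0) :
    φ b ≤ φ 0 + φ' 0 * b + M / 2 * b ^ 2 := by
  have key : ∀ b, 0 ≤ b → φ b ≤ φ 0 → φ b ≤ φ 0 + φ' 0 * b + M / 2 * b ^ 2 := fun b hb hle =>
    (le_quadratic_of_deriv2_le h1 h2 hb fun a ha hab =>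
      hM a ha (le_of_convexOn_of_le hφ ha hab hle)).2
  refine key b hb ?_
  by_contra! hlt
  have hb0 : 0 < b := hb.lt_of_ne (by rintro rfl; exact lt_irrefl _ hlt)
  have hneg : φ' 0 < 0 := by nlinarith
  -- If `φ b > φ 0`, then `φ`, which first decreases, returns to the value `φ 0` at some `r ≤ b`.
  -- The quadratic bound at `r` gives `-φ' 0 ≤ M r / 2`, against `M r ≤ -φ' 0` and `φ' 0 < 0`.
  obtain ⟨s, hs, hs0⟩ : ∃ s, φ s < φ 0 ∧ 0 < s ∧ s < b := by
    have hslope := (hasDerivAt_iff_tendsto_slope.1 (h1 0)).eventually_lt_const hneg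
    have hnhds : ∀ᶠ s in nhdsWithin (0 : ℝ) (Set.Ioi 0), slope φ 0 s < 0 :=
      hslope.filter_mono (nhdsWithin_mono _ fun s hs => ne_of_gt hs)
    obtain ⟨s, hs, hmem⟩ := (hnhds.and (Ioo_mem_nhdsGT hb0)).exists
    refine ⟨s, ?_, hmem⟩
    rw [slope_def_field, sub_zero, div_neg_iff] at hs
    rcases hs with hs | hs
    · linarith [hs.2, hmem.1]
    · linarith [hs.1]
  obtain ⟨r, ⟨hr1, hr2⟩, hr⟩ : φ 0 ∈ φ '' Set.Icc s b :=
    intermediate_value_Icc hs0.2.le (fun a _ => (h1 a).continuousAt.continuousWithinAt)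
      ⟨hs.le, hlt.le⟩
  have := key r (by linarith) hr.le
  have hr0 : 0 < r := by linarith
  nlinarith [mul_le_mul_of_nonneg_left hr2 hM0.le]

end OneDim

/-! ### The risk, its gradient and its curvature along a line -/

section Risk

variable {m n : ℕ} {ℓ : ℝ → ℝ}

theorem card_mul_risk (hm : 0 < m) (z : Fin m → ℝ) : m * risk ℓ z = ∑ i, ℓ (z i) := by
  have : (m : ℝ) ≠ 0 := by positivity
  rw [risk, mul_inv_cancel_left₀ this]

theorem LossClass.risk_pos (hℓ : LossClass ℓ) (hm : 0 < m) (z : Fin m → ℝ) : 0 < risk ℓ z := by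
  have : Nonempty (Fin m) := ⟨⟨0, hm⟩⟩
  have : 0 < ∑ i, ℓ (z i) := Finset.sum_pos (fun i _ => hℓ.pos _) Finset.univ_nonempty
  unfold risk
  positivity

theorem LossClass.riskGrad_apply (hℓ : LossClass ℓ) (z : Fin m → ℝ) (i : Fin m) :
    riskGrad ℓ z i = (m : ℝ)⁻¹ * deriv ℓ (z i) := by
  have h : HasFDerivAt (risk ℓ) ((m : ℝ)⁻¹ • ∑ i : Fin m,
      deriv ℓ (z i) • (ContinuousLinearMap.proj i : (Fin m → ℝ) →L[ℝ] ℝ)) z := by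
    unfold risk
    refine HasFDerivAt.const_mul (HasFDerivAt.fun_sum fun i _ => ?_) _
    exact (hℓ.hasDerivAt (z i)).comp_hasFDerivAt z (hasFDerivAt_apply i z)
  rw [riskGrad, h.fderiv]
  simp [Pi.single_apply]

theorem LossClass.riskGrad_dotProduct (hℓ : LossClass ℓ) (z q : Fin m → ℝ) :
    riskGrad ℓ z ⬝ᵥ q = (m : ℝ)⁻¹ * ∑ i, deriv ℓ (z i) * q i := by
  simp only [dotProduct, hℓ.riskGrad_apply, Finset.mul_sum, mul_assoc]

theorem LossClass.l1norm_riskGrad (hℓ : LossClass ℓ) (z : Fin m → ℝ) :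
    l1norm (riskGrad ℓ z) = (m : ℝ)⁻¹ * ∑ i, deriv ℓ (z i) := by
  simp only [l1norm, hℓ.riskGrad_apply, Finset.mul_sum]
  refine Finset.sum_congr rfl fun i _ => abs_of_nonneg ?_
  have := hℓ.deriv_pos (z i)
  positivity

theorem LossClass.convexOn_risk (hℓ : LossClass ℓ) :
    ConvexOn ℝ Set.univ (risk ℓ : (Fin m → ℝ) → ℝ) := by
  refine ⟨convex_univ, fun x _ y _ a b ha hb hab => ?_⟩
  simp only [risk, smul_eq_mul, mul_left_comm _ (m : ℝ)⁻¹, ← mul_add]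
  rw [Finset.mul_sum _ (fun i => ℓ (x i)), Finset.mul_sum _ (fun i => ℓ (y i)),
    ← Finset.sum_add_distrib]
  refine mul_le_mul_of_nonneg_left (Finset.sum_le_sum fun i _ => ?_) (by positivity)
  exact hℓ.strictConvex.convexOn.2 (Set.mem_univ (x i)) (Set.mem_univ (y i)) ha hb hab

theorem LossClass.convexOn_risk_line (hℓ : LossClass ℓ) (p q : Fin m → ℝ) :
    ConvexOn ℝ Set.univ fun a : ℝ => risk ℓ (p + a • q) := by
  refine ⟨convex_univ, fun x _ y _ a b ha hb hab => ?_⟩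
  have h := hℓ.convexOn_risk.2 (Set.mem_univ (p + x • q)) (Set.mem_univ (p + y • q)) ha hb hab
  have he : p + (a • x + b • y) • q = a • (p + x • q) + b • (p + y • q) := by
    ext i
    simp only [Pi.add_apply, Pi.smul_apply, smul_eq_mul]
    linear_combination (-p i) * hab
  simpa only [he] using h

theorem LossClass.hasDerivAt_risk_line (hℓ : LossClass ℓ) (p q : Fin m → ℝ) (a : ℝ) :
    HasDerivAt (fun a : ℝ => risk ℓ (p + a • q)) (riskGrad ℓ (p + a • q) ⬝ᵥ q) a := by
  rw [hℓ.riskGrad_dotProduct]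
  refine HasDerivAt.const_mul _ (HasDerivAt.fun_sum fun i _ => ?_)
  have hlin : HasDerivAt (fun a : ℝ => (p + a • q) i) (q i) a := by
    simpa using ((hasDerivAt_id a).mul_const (q i)).const_add (p i)
  exact (hℓ.hasDerivAt _).comp a hlin

theorem LossClass.hasDerivAt_riskGrad_line (hℓ : LossClass ℓ) (p q : Fin m → ℝ) (a : ℝ) :
    HasDerivAt (fun a : ℝ => riskGrad ℓ (p + a • q) ⬝ᵥ q)
      ((m : ℝ)⁻¹ * ∑ i, deriv (deriv ℓ) ((p + a • q) i) * q i ^ 2) a := by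
  simp only [hℓ.riskGrad_dotProduct]
  refine HasDerivAt.const_mul _ (HasDerivAt.fun_sum fun i _ => ?_)
  have hlin : HasDerivAt (fun a : ℝ => (p + a • q) i) (q i) a := by
    simpa using ((hasDerivAt_id a).mul_const (q i)).const_add (p i)
  exact (((hℓ.hasDerivAt_deriv _).comp a hlin).mul_const (q i)).congr_deriv (by ring)

theorem LossClass.add_dotProduct_le (hℓ : LossClass ℓ) (p w : Fin m → ℝ) :
    risk ℓ p + riskGrad ℓ p ⬝ᵥ (w - p) ≤ risk ℓ w := by
  rw [hℓ.riskGrad_dotProduct, risk, risk, ← mul_add, ← Finset.sum_add_distrib]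
  exact mul_le_mul_of_nonneg_left (Finset.sum_le_sum fun i _ => hℓ.add_mul_le _ _) (by positivity)

/-- Predictions of risk at most `r` are at most `ℓ⁻¹ (m r)`. -/
theorem LossClass.le_level (hℓ : LossClass ℓ) (hm : 0 < m) {w : Fin m → ℝ} {r : ℝ}
    (h : risk ℓ w ≤ r) (i : Fin m) : w i ≤ Function.invFun ℓ (m * r) := by
  refine hℓ.le_invFun ?_
  calc ℓ (w i) ≤ ∑ j, ℓ (w j) :=
        Finset.single_le_sum (f := fun j => ℓ (w j)) (fun j _ => hℓ.nonneg _) (Finset.mem_univ i)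
    _ = m * risk ℓ w := (card_mul_risk hm w).symm
    _ ≤ m * r := by gcongr

theorem LossClass.risk_le_l1norm (hℓ : LossClass ℓ) (hm : 0 < m) {w : Fin m → ℝ} {r : ℝ}
    (h : risk ℓ w ≤ r) : risk ℓ w ≤
      (lossConst ℓ (Function.invFun ℓ (m * r))).toReal ^ 2 * l1norm (riskGrad ℓ w) := by
  rw [hℓ.l1norm_riskGrad, risk, mul_left_comm, Finset.mul_sum Finset.univ _ (_ ^ 2)]
  exact mul_le_mul_of_nonneg_left
    (Finset.sum_le_sum fun i _ => hℓ.le_deriv (hℓ.le_level hm h i)) (by positivity)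

theorem LossClass.l1norm_le_risk (hℓ : LossClass ℓ) (hm : 0 < m) {w : Fin m → ℝ} {r : ℝ}
    (h : risk ℓ w ≤ r) : l1norm (riskGrad ℓ w) ≤
      (lossConst ℓ (Function.invFun ℓ (m * r))).toReal ^ 2 * risk ℓ w := by
  rw [hℓ.l1norm_riskGrad, risk, mul_left_comm, Finset.mul_sum Finset.univ _ (_ ^ 2)]
  exact mul_le_mul_of_nonneg_left
    (Finset.sum_le_sum fun i _ => hℓ.deriv_le (hℓ.le_level hm h i)) (by positivity)

theorem LossClass.l1norm_riskGrad_pos (hℓ : LossClass ℓ) (hm : 0 < m) (w : Fin m → ℝ) :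
    0 < l1norm (riskGrad ℓ w) := by
  have h1 := hℓ.risk_le_l1norm hm (le_refl (risk ℓ w))
  have h2 := hℓ.risk_pos hm w
  by_contra! hneg
  exact absurd (h2.trans_le h1) (not_lt.2 (mul_nonpos_of_nonneg_of_nonpos (by positivity) hneg))

/-- Two factors `C` replace `ℓ''` by `ℓ` at `w`; the risk then only grows from `w` to `p`, where two
more replace `ℓ` by `ℓ'`. The start of a step thus controls the curvature on its whole sublevel set.
-/
theorem LossClass.second_deriv_le (hℓ : LossClass ℓ) (hm : 0 < m) {w p q : Fin m → ℝ}
    (h : risk ℓ w ≤ risk ℓ p) (hq : ∀ i, |q i| ≤ 1) :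
    (m : ℝ)⁻¹ * ∑ i, deriv (deriv ℓ) (w i) * q i ^ 2 ≤
      (lossConst ℓ (Function.invFun ℓ (m * risk ℓ p))).toReal ^ 4 * l1norm (riskGrad ℓ p) := by
  set C := (lossConst ℓ (Function.invFun ℓ (m * risk ℓ p))).toReal
  calc (m : ℝ)⁻¹ * ∑ i, deriv (deriv ℓ) (w i) * q i ^ 2
      ≤ (m : ℝ)⁻¹ * ∑ i, C ^ 2 * ℓ (w i) := by
        refine mul_le_mul_of_nonneg_left (Finset.sum_le_sum fun i _ => ?_) (by positivity)
        have hq2 : q i ^ 2 ≤ 1 := (sq_le_one_iff_abs_le_one _).2 (hq i)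
        exact (mul_le_of_le_one_right (hℓ.deriv2_pos _).le hq2).trans
          (hℓ.deriv2_le (hℓ.le_level hm h i))
    _ = C ^ 2 * risk ℓ w := by rw [← Finset.mul_sum, risk, mul_left_comm]
    _ ≤ C ^ 2 * (C ^ 2 * l1norm (riskGrad ℓ p)) := by
        gcongr
        exact h.trans (hℓ.risk_le_l1norm hm le_rfl)
    _ = _ := by ring

/-! ### Descent directions and the four step rules -/

theorem dotProduct_mulVec_eq_colGrad (A : Matrix (Fin m) (Fin n) ℝ) (x w : Fin n → ℝ) :
    riskGrad ℓ (A *ᵥ x) ⬝ᵥ (A *ᵥ w) = colGrad A ℓ x ⬝ᵥ w := by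
  rw [Matrix.dotProduct_mulVec, colGrad, Matrix.mulVec_transpose]

theorem abs_dotProduct_le {k : ℕ} (u w : Fin k → ℝ) : |u ⬝ᵥ w| ≤ ‖u‖ * l1norm w := by
  rw [l1norm, Finset.mul_sum]
  refine (Finset.abs_sum_le_sum_abs _ _).trans (Finset.sum_le_sum fun i _ => ?_)
  rw [abs_mul]
  exact mul_le_mul_of_nonneg_right (norm_le_pi_norm u i) (abs_nonneg _)

theorem IsDirection.abs_mulVec_le {A : Matrix (Fin m) (Fin n) ℝ} (hA : ∀ i j, |A i j| ≤ 1)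
    {x v : Fin n → ℝ} (hv : IsDirection A ℓ x v) (i : Fin m) : |(A *ᵥ v) i| ≤ 1 := by
  obtain ⟨j, -, rfl | rfl, -⟩ := hv
  · simpa using hA i j
  · simpa [Matrix.mulVec_neg] using hA i j

theorem IsDirection.mulVec_eq {A : Matrix (Fin m) (Fin n) ℝ} (hA : ∀ i j, A i j = -1 ∨ A i j = 1)
    {x v : Fin n → ℝ} (hv : IsDirection A ℓ x v) (i : Fin m) :
    (A *ᵥ v) i = -1 ∨ (A *ᵥ v) i = 1 := by
  obtain ⟨j, -, rfl | rfl, -⟩ := hv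
  · simpa using hA i j
  · rcases hA i j with h | h <;> simp [Matrix.mulVec_neg, h]

/-- The unshrunk AdaBoost step is an exact line search. -/
theorem isMinOn_adaBoost (hm : 0 < m) (hℓ : LossClass Real.exp) {A : Matrix (Fin m) (Fin n) ℝ}
    (hA : ∀ i j, A i j = -1 ∨ A i j = 1) {x v : Fin n → ℝ} (hv : IsDirection A Real.exp x v)
    (hγ : stepGamma A Real.exp x < 1) :
    IsMinOn (fun β : ℝ => risk Real.exp (A *ᵥ (x + β • v))) Set.univ
      (1 / 2 * Real.log ((1 + stepGamma A Real.exp x) / (1 - stepGamma A Real.exp x))) := by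
  set γ := stepGamma A Real.exp x with hγdef
  set p := A *ᵥ x with hp
  set q := A *ᵥ v with hq
  have hg := hℓ.l1norm_riskGrad_pos hm p
  have hγ0 : 0 ≤ γ := div_nonneg (norm_nonneg _) hg.le
  have hsub : 0 < 1 - γ := by linarith
  have hadd : 0 < 1 + γ := by linarith
  set b := 1 / 2 * Real.log ((1 + γ) / (1 - γ)) with hb
  have hexp : Real.exp b ^ 2 * (1 - γ) = 1 + γ := by
    rw [← Real.exp_nat_mul, hb]
    have : ((2 : ℕ) : ℝ) * (1 / 2 * Real.log ((1 + γ) / (1 - γ))) =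
      Real.log ((1 + γ) / (1 - γ)) := by push_cast; ring
    rw [this, Real.exp_log (by positivity)]
    field_simp
  have hdot : ∀ z : Fin m → ℝ,
      riskGrad Real.exp z ⬝ᵥ q = (m : ℝ)⁻¹ * ∑ i, Real.exp (z i) * q i := fun z => by
    rw [hℓ.riskGrad_dotProduct, Real.deriv_exp]
  have hl1 : l1norm (riskGrad Real.exp p) = (m : ℝ)⁻¹ * ∑ i, Real.exp (p i) := by
    rw [hℓ.l1norm_riskGrad, Real.deriv_exp]
  have h0 : riskGrad Real.exp p ⬝ᵥ q = -γ * l1norm (riskGrad Real.exp p) := by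
    obtain ⟨-, -, -, h⟩ := hv
    rw [h, hγdef, stepGamma, neg_mul, div_mul_cancel₀ _ hg.ne']
  have hzero : riskGrad Real.exp (p + b • q) ⬝ᵥ q = 0 := by
    -- As `q i = ±1`, `exp (b * q i) * q i = sinh b + cosh b * q i`.
    have hterm : ∀ i, Real.exp ((p + b • q) i) * q i =
        (Real.exp b - (Real.exp b)⁻¹) / 2 * Real.exp (p i) +
          (Real.exp b + (Real.exp b)⁻¹) / 2 * (Real.exp (p i) * q i) := fun i => by
      simp only [Pi.add_apply, Pi.smul_apply, smul_eq_mul]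
      rcases hv.mulVec_eq hA i with h | h <;> rw [← hq] at h <;> rw [h, Real.exp_add]
      · rw [show b * -1 = -b by ring, Real.exp_neg]; ring
      · ring_nf
    have hsum : (m : ℝ)⁻¹ * ∑ i, Real.exp ((p + b • q) i) * q i =
        (Real.exp b - (Real.exp b)⁻¹) / 2 * l1norm (riskGrad Real.exp p) +
          (Real.exp b + (Real.exp b)⁻¹) / 2 * (riskGrad Real.exp p ⬝ᵥ q) := by
      rw [hl1, hdot]
      simp only [hterm, Finset.sum_add_distrib, ← Finset.mul_sum]
      ring
    rw [hdot, hsum, h0]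
    have he := Real.exp_pos b
    field_simp
    linear_combination l1norm (riskGrad Real.exp p) * hexp
  have hline : (fun β : ℝ => risk Real.exp (A *ᵥ (x + β • v))) =
      fun β : ℝ => risk Real.exp (p + β • q) := by
    funext β
    rw [Matrix.mulVec_add, Matrix.mulVec_smul]
  rw [hline]
  intro β _
  have h1 := hℓ.add_dotProduct_le (p + b • q) (p + β • q)
  have h2 : p + β • q - (p + b • q) = (β - b) • q := by rw [sub_smul]; abel
  rw [h2, dotProduct_smul, hzero, smul_zero, add_zero] at h1
  exact h1

/-- All step size rules decrease the risk by a multiple of the squared gradient norm. -/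
theorem sufficient_decrease (hm : 0 < m) {A : Matrix (Fin m) (Fin n) ℝ}
    (hA : ∀ i j, |A i j| ≤ 1) {ν : ℝ} (hν0 : 0 < ν) (hν1 : ν ≤ 1) (hℓ : LossClass ℓ)
    {rule : StepRule} (hrule : rule = .adaBoost → ℓ = Real.exp ∧ ∀ i j, A i j = -1 ∨ A i j = 1)
    {x v : Fin n → ℝ} {α : ℝ} (hv : IsDirection A ℓ x v) (hα : IsStepSize A ℓ ν x v α rule) :
    risk ℓ (A *ᵥ (x + α • v)) ≤ risk ℓ (A *ᵥ x) -
      ν * ‖colGrad A ℓ x‖ ^ 2 / (8 * (stepConst A ℓ x ^ 4 * l1norm (riskGrad ℓ (A *ᵥ x)))) := by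
  have hC : 1 ≤ stepConst A ℓ x := (hℓ.expLike _).1
  have hg := hℓ.l1norm_riskGrad_pos hm (A *ᵥ x)
  set G := ‖colGrad A ℓ x‖ with hG
  set g := l1norm (riskGrad ℓ (A *ᵥ x)) with hgdef
  set M := stepConst A ℓ x ^ 4 * g with hM
  have hM0 : 0 < M := by positivity
  have hG0 : 0 ≤ G := norm_nonneg _
  set φ : ℝ → ℝ := fun a => risk ℓ (A *ᵥ x + a • (A *ᵥ v)) with hφ
  have hline : ∀ a : ℝ, A *ᵥ (x + a • v) = A *ᵥ x + a • (A *ᵥ v) := fun a => by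
    rw [Matrix.mulVec_add, Matrix.mulVec_smul]
  have hφ0 : φ 0 = risk ℓ (A *ᵥ x) := by simp [hφ]
  have hd0 : riskGrad ℓ (A *ᵥ x + (0 : ℝ) • (A *ᵥ v)) ⬝ᵥ (A *ᵥ v) = -G := by
    rw [zero_smul, add_zero]
    obtain ⟨-, -, -, h⟩ := hv
    exact h
  have hd1 := hℓ.hasDerivAt_risk_line (A *ᵥ x) (A *ᵥ v)
  have hd2 := hℓ.hasDerivAt_riskGrad_line (A *ᵥ x) (A *ᵥ v)
  have hconv := hℓ.convexOn_risk_line (A *ᵥ x) (A *ᵥ v)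
  have hMle : ∀ a, 0 ≤ a → φ a ≤ φ 0 →
      (m : ℝ)⁻¹ * ∑ i, deriv (deriv ℓ) ((A *ᵥ x + a • (A *ᵥ v)) i) * (A *ᵥ v) i ^ 2 ≤ M :=
    fun a _ ha => hℓ.second_deriv_le hm (ha.trans_eq hφ0) (hv.abs_mulVec_le hA)
  have hquad : ∀ b, 0 ≤ b → M * b ≤ G → φ b ≤ φ 0 - G * b + M / 2 * b ^ 2 := fun b hb hbM => by
    have := le_quadratic_of_sublevel hd1 hd2 hconv hM0 hMle hb (by rw [hd0, neg_neg]; exact hbM)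
    rw [hd0] at this
    linarith
  have hopt : ∀ α₁ : ℝ, IsMinOn (fun β : ℝ => risk ℓ (A *ᵥ (x + β • v))) Set.univ α₁ →
      risk ℓ (A *ᵥ (x + (ν * α₁) • v)) ≤ risk ℓ (A *ᵥ x) - ν * G ^ 2 / (8 * M) := by
    intro α₁ hmin
    -- The exact line search does at least as well as the minimizer `G / M` of the quadratic bound.
    have h1 : φ α₁ ≤ φ (G / M) := by
      have := hmin (Set.mem_univ (G / M))
      simpa only [Set.mem_ofPred_eq, hline] using this
    have h2 := hquad (G / M) (by positivity) (by rw [mul_div_cancel₀ _ hM0.ne'])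
    -- By convexity the shrunk step keeps at least the fraction `ν` of the decrease.
    have h3 : φ (ν * α₁) ≤ (1 - ν) * φ 0 + ν * φ α₁ := by
      have := hconv.2 (Set.mem_univ 0) (Set.mem_univ α₁) (sub_nonneg.2 hν1) hν0.le (by ring)
      simpa only [smul_eq_mul, mul_zero, zero_add] using this
    rw [hline, ← hφ0]
    have h4 : G * (G / M) - M / 2 * (G / M) ^ 2 = G ^ 2 / (2 * M) := by field_simp; ring
    have h5 : ν * G ^ 2 / (8 * M) = ν * (G ^ 2 / (2 * M)) / 4 := by field_simp; ring
    have h6 : 0 ≤ G ^ 2 / (2 * M) := by positivity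
    change φ (ν * α₁) ≤ _
    rw [h5]
    have h7 : φ α₁ ≤ φ 0 - G ^ 2 / (2 * M) := by linarith
    have h8 := mul_le_mul_of_nonneg_left h7 hν0.le
    have h9 := mul_nonneg hν0.le h6
    nlinarith
  cases rule with
  | quadUpper =>
    have hα' : α = ν * G / M := by
      rw [show α = ν * stepGamma A ℓ x / stepConst A ℓ x ^ 4 from hα, stepGamma, hM, ← hG, ← hgdef]
      field_simp
    have h2 := hquad α (by rw [hα']; positivity)
      (by rw [hα', mul_div_cancel₀ _ hM0.ne']; nlinarith)
    rw [hline, ← hφ0]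
    refine h2.trans ?_
    have h4 : G * α - M / 2 * α ^ 2 = (8 * ν - 4 * ν ^ 2) * (G ^ 2 / (8 * M)) := by
      rw [hα']; field_simp; ring
    have h5 : ν * G ^ 2 / (8 * M) = ν * (G ^ 2 / (8 * M)) := by ring
    have h6 : 0 ≤ G ^ 2 / (8 * M) := by positivity
    have h7 : ν ≤ 8 * ν - 4 * ν ^ 2 := by nlinarith
    have := mul_le_mul_of_nonneg_right h7 h6
    linarith
  | wolfe =>
    obtain ⟨h1, h2⟩ := hα
    rw [hline] at h1 h2 ⊢
    rcases hG0.eq_or_lt with hG' | hGpos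
    · rw [show ‖colGrad A ℓ x‖ = 0 from hG'.symm] at h1
      simpa [← hG'] using h1
    -- The slope along the line is nondecreasing, so at `α ≤ 0` it would be at most `-G`, violating
    -- the curvature condition.
    have hαpos : 0 < α := by
      by_contra! hneg
      have hmono : Monotone fun a : ℝ => riskGrad ℓ (A *ᵥ x + a • (A *ᵥ v)) ⬝ᵥ (A *ᵥ v) := by
        refine monotone_of_deriv_nonneg (fun a => (hd2 a).differentiableAt) fun a => ?_
        rw [(hd2 a).deriv]
        refine mul_nonneg (by positivity) (Finset.sum_nonneg fun i _ => ?_)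
        exact mul_nonneg (hℓ.deriv2_pos _).le (sq_nonneg _)
      have := hmono hneg
      simp only [hd0] at this
      nlinarith
    have hle : φ α ≤ φ 0 := by
      rw [hφ0]
      refine h1.trans (sub_le_self _ ?_)
      have : 0 < 1 - ν / 2 := by linarith
      positivity
    -- The curvature condition needs the slope to rise by `ν G / 4`, and it rises at rate at most
    -- `M`; this bounds `α` from below.
    have h3 := (le_quadratic_of_deriv2_le hd1 hd2 hαpos.le fun a ha hab =>
      hMle a ha (le_of_convexOn_of_le hconv ha hab hle)).1
    rw [hd0] at h3
    have h4 : ν * G / 4 ≤ M * α := by linarith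
    have h5 : ν * G / (4 * M) ≤ α := by
      rw [div_le_iff₀ (by positivity)]; linarith
    refine h1.trans (sub_le_sub_left ?_ _)
    calc ν * G ^ 2 / (8 * M) = ν * G / (4 * M) * (1 / 2) * G := by field_simp; ring
      _ ≤ α * (1 - ν / 2) * G := by
        refine mul_le_mul_of_nonneg_right ?_ hG0
        exact mul_le_mul h5 (by linarith) (by norm_num) hαpos.le
  | adaBoost =>
    obtain ⟨rfl, hA'⟩ := hrule rfl
    obtain ⟨hγ, hα⟩ := hα
    have := hopt _ (isMinOn_adaBoost hm hℓ hA' hv hγ)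
    rwa [← mul_assoc, mul_one_div, ← hα] at this
  | optimal =>
    obtain ⟨α₁, hmin, rfl⟩ := hα
    exact hopt α₁ hmin

end Risk

/-! ### Hard cores -/

section HardCore

variable {m n : ℕ} {ℓ : ℝ → ℝ} {A : Matrix (Fin m) (Fin n) ℝ} {H : Finset (Fin m)}

theorem l1norm_nonneg {k : ℕ} (x : Fin k → ℝ) : 0 ≤ l1norm x :=
  Finset.sum_nonneg fun _ _ => abs_nonneg _

theorem l1norm_le_card_mul_norm {k : ℕ} (x : Fin k → ℝ) : l1norm x ≤ k * ‖x‖ := by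
  calc l1norm x ≤ ∑ _i : Fin k, ‖x‖ := Finset.sum_le_sum fun i _ => norm_le_pi_norm x i
    _ = k * ‖x‖ := by simp

theorem l1norm_add_smul_le {k : ℕ} (x y : Fin k → ℝ) (s : ℝ) :
    l1norm (x + s • y) ≤ l1norm x + |s| * l1norm y := by
  rw [l1norm, l1norm, l1norm, Finset.mul_sum, ← Finset.sum_add_distrib]
  refine Finset.sum_le_sum fun i _ => ?_
  rw [← abs_mul]
  exact abs_add_le (x i) (s * y i)

theorem abs_mulVec_le_l1norm (hA : ∀ i j, |A i j| ≤ 1) (x : Fin n → ℝ) (i : Fin m) :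
    |(A *ᵥ x) i| ≤ l1norm x := by
  refine (abs_dotProduct_le (A i) x).trans (mul_le_of_le_one_left (l1norm_nonneg x) ?_)
  exact (pi_norm_le_iff_of_nonneg zero_le_one).2 (hA i)

/-- Every matrix has a hard core: the rows that no weighting correct on all rows classifies
strictly. -/
theorem exists_isHardCore (A : Matrix (Fin m) (Fin n) ℝ) : ∃ H, IsHardCore A H := by
  classical
  set P : Fin m → Prop := fun i => ∃ x : Fin n → ℝ, (∀ k, (A *ᵥ x) k ≤ 0) ∧ (A *ᵥ x) i < 0
    with hP
  have hw : ∀ i, ∃ x : Fin n → ℝ, (∀ k, (A *ᵥ x) k ≤ 0) ∧ (P i → (A *ᵥ x) i < 0) := fun i => by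
    by_cases h : P i
    · obtain ⟨x, h1, h2⟩ := h
      exact ⟨x, h1, fun _ => h2⟩
    · exact ⟨0, fun k => by simp, fun h' => absurd h' h⟩
  choose w hw1 hw2 using hw
  set u : Fin n → ℝ := ∑ i, w i with hu
  have hsum : ∀ k, (A *ᵥ u) k = ∑ i, (A *ᵥ w i) k := fun k => by
    rw [hu, Matrix.mulVec_sum, Finset.sum_apply]
  have hu0 : ∀ k, (A *ᵥ u) k ≤ 0 := fun k => by
    rw [hsum]
    exact Finset.sum_nonpos fun i _ => hw1 i k
  have huP : ∀ k, P k → (A *ᵥ u) k < 0 := fun k hk => by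
    rw [hsum]
    exact Finset.sum_neg' (fun i _ => hw1 i k) ⟨k, Finset.mem_univ k, hw2 k hk⟩
  refine ⟨Finset.univ.filter fun i => ¬ P i, ⟨u, fun i hi => huP i (by simpa using hi),
    fun i hi => ?_⟩, ?_⟩
  · have hi' : ¬ P i := by simpa using hi
    exact le_antisymm (hu0 i) (not_lt.1 fun h => hi' ⟨u, hu0, h⟩)
  · rintro x ⟨i, hi, hx⟩
    by_contra! hcon
    have hi' : ¬ P i := by simpa using hi
    -- With this `s`, `s • u` compensates `x` on every row with `P`. Rows where `A *ᵥ u` vanishes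
    -- contribute `0`. The combination errs on no row and is strict at `i`, so `P i` would hold.
    set s : ℝ := ∑ k, |(A *ᵥ x) k| / |(A *ᵥ u) k| with hs
    have hs0 : 0 ≤ s := Finset.sum_nonneg fun k _ => by positivity
    have hval : ∀ k, (A *ᵥ (x + s • u)) k = (A *ᵥ x) k + s * (A *ᵥ u) k := fun k => by
      rw [Matrix.mulVec_add, Matrix.mulVec_smul]; rfl
    refine hi' ⟨x + s • u, fun k => ?_, ?_⟩
    · rw [hval]
      by_cases hk : P k
      · have h1 := huP k hk
        have h2 : |(A *ᵥ x) k| / |(A *ᵥ u) k| ≤ s :=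
          Finset.single_le_sum (f := fun k => |(A *ᵥ x) k| / |(A *ᵥ u) k|)
            (fun k _ => by positivity) (Finset.mem_univ k)
        rw [div_le_iff₀ (abs_pos.2 h1.ne), abs_of_neg h1] at h2
        linarith [le_abs_self ((A *ᵥ x) k)]
      · have := hcon k (by simpa using hk)
        linarith [mul_nonpos_of_nonneg_of_nonpos hs0 (hu0 k)]
    · rw [hval]
      linarith [mul_nonpos_of_nonneg_of_nonpos hs0 (hu0 i)]

theorem IsHardCore.exists_le_neg_one (hH : IsHardCore A H) :
    ∃ x : Fin n → ℝ, (∀ i ∉ H, (A *ᵥ x) i ≤ -1) ∧ ∀ i ∈ H, (A *ᵥ x) i = 0 := by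
  obtain ⟨⟨u, hu, hu0⟩, -⟩ := hH
  set s : ℝ := ∑ k, |(A *ᵥ u) k|⁻¹ with hs
  refine ⟨s • u, fun i hi => ?_, fun i hi => ?_⟩
  · rw [Matrix.mulVec_smul, Pi.smul_apply, smul_eq_mul]
    have h2 : |(A *ᵥ u) i|⁻¹ ≤ s :=
      Finset.single_le_sum (f := fun k => |(A *ᵥ u) k|⁻¹) (fun k _ => by positivity)
        (Finset.mem_univ i)
    have h1 := hu i hi
    rw [inv_le_iff_one_le_mul₀ (abs_pos.2 h1.ne), abs_of_neg h1] at h2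
    linarith
  · rw [Matrix.mulVec_smul, Pi.smul_apply, hu0 i hi, smul_zero]

/-- Predictions on the rows in `H`, extended by zero. -/
noncomputable def rowsMap (A : Matrix (Fin m) (Fin n) ℝ) (H : Finset (Fin m)) :
    (Fin n → ℝ) →ₗ[ℝ] (Fin m → ℝ) :=
  (LinearMap.pi fun i => if i ∈ H then LinearMap.proj i else 0) ∘ₗ A.mulVecLin

theorem rowsMap_apply_of_mem {i : Fin m} (hi : i ∈ H) (x : Fin n → ℝ) :
    rowsMap A H x i = (A *ᵥ x) i := by
  simp [rowsMap, hi]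

theorem rowsMap_apply_of_notMem {i : Fin m} (hi : i ∉ H) (x : Fin n → ℝ) :
    rowsMap A H x i = 0 := by
  simp [rowsMap, hi]

theorem norm_rowsMap_le {x : Fin n → ℝ} {d : ℝ} (hd : 0 ≤ d)
    (h : ∀ i ∈ H, |(A *ᵥ x) i| ≤ d) : ‖rowsMap A H x‖ ≤ d := by
  refine (pi_norm_le_iff_of_nonneg hd).2 fun i => ?_
  by_cases hi : i ∈ H
  · rw [rowsMap_apply_of_mem hi]
    exact h i hi
  · rw [rowsMap_apply_of_notMem hi, norm_zero]
    exact hd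

/-- Predictions on `H` are realized by a weighting of proportionate size. -/
theorem exists_preimage_bound (A : Matrix (Fin m) (Fin n) ℝ) (H : Finset (Fin m)) :
    ∃ κ : ℝ, 0 ≤ κ ∧ ∀ x : Fin n → ℝ, ∃ y : Fin n → ℝ, (∀ i ∈ H, (A *ᵥ y) i = (A *ᵥ x) i) ∧
      ∀ d : ℝ, 0 ≤ d → (∀ i ∈ H, |(A *ᵥ x) i| ≤ d) → l1norm y ≤ κ * d := by
  -- A linear section of the map onto its range is bounded in finite dimension; `n` converts the sup
  -- norm to the ℓ¹ norm.
  obtain ⟨g, hg⟩ := (rowsMap A H).rangeRestrict.exists_rightInverse_of_surjective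
    (LinearMap.range_rangeRestrict _)
  set g' := LinearMap.toContinuousLinearMap g with hg'
  refine ⟨n * ‖g'‖, by positivity, fun x => ⟨g ((rowsMap A H).rangeRestrict x), fun i hi => ?_,
    fun d hd h => ?_⟩⟩
  · rw [← rowsMap_apply_of_mem hi, ← rowsMap_apply_of_mem hi]
    have h1 := LinearMap.congr_fun hg ((rowsMap A H).rangeRestrict x)
    exact congrFun (congrArg Subtype.val h1) i
  · refine (l1norm_le_card_mul_norm _).trans ?_
    rw [mul_assoc]
    refine mul_le_mul_of_nonneg_left ?_ (by positivity)
    refine (g'.le_opNorm _).trans (mul_le_mul_of_nonneg_left ?_ (norm_nonneg _))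
    exact norm_rowsMap_le hd h

/-- On a hard core, an upper bound on the predictions entails a lower bound. -/
theorem IsHardCore.exists_abs_bound (hH : IsHardCore A H) :
    ∃ κ : ℝ, 0 ≤ κ ∧ ∀ b : ℝ, 0 ≤ b → ∀ x : Fin n → ℝ, (∀ i ∈ H, (A *ᵥ x) i ≤ b) →
      ∀ i ∈ H, |(A *ᵥ x) i| ≤ κ * b := by
  set S : Set (Fin m → ℝ) := Metric.sphere 0 1 ∩ LinearMap.range (rowsMap A H) with hS
  have hcomp : IsCompact S :=
    (isCompact_sphere 0 1).inter_right (Submodule.closed_of_finiteDimensional _)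
  -- The sum of positive parts is positive on `S` by the hard core property, so compactness bounds
  -- it below there. Homogeneity extends the bound to all predictions on `H`.
  set F : (Fin m → ℝ) → ℝ := fun w => ∑ i, max (w i) 0 with hF
  have hcont : Continuous F := by fun_prop
  have hpos : ∀ w ∈ S, 0 < F w := by
    rintro w ⟨hw1, x, rfl⟩
    suffices h : ∃ k ∈ H, 0 < (A *ᵥ x) k by
      obtain ⟨k, hk, hkpos⟩ := h
      refine Finset.sum_pos' (fun i _ => le_max_right _ _) ⟨k, Finset.mem_univ k, ?_⟩
      rw [rowsMap_apply_of_mem hk]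
      exact lt_max_of_lt_left hkpos
    by_contra! hcon
    have hzero : ∀ i ∈ H, (A *ᵥ x) i = 0 := fun i hi => by
      refine le_antisymm (hcon i hi) (not_lt.1 fun hneg => ?_)
      obtain ⟨k, hk, hkpos⟩ := hH.2 x ⟨i, hi, hneg⟩
      exact absurd hkpos (not_lt.2 (hcon k hk))
    have hnorm : ‖rowsMap A H x‖ ≤ 0 :=
      norm_rowsMap_le le_rfl fun i hi => by rw [hzero i hi, abs_zero]
    rw [mem_sphere_zero_iff_norm] at hw1
    linarith
  obtain ⟨c, hc, hcF⟩ : ∃ c : ℝ, 0 < c ∧ ∀ w ∈ S, c ≤ F w := by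
    rcases S.eq_empty_or_nonempty with h | h
    · exact ⟨1, one_pos, fun w hw => by simp [h] at hw⟩
    · obtain ⟨w, hw, hmin⟩ := hcomp.exists_isMinOn h hcont.continuousOn
      exact ⟨F w, hpos w hw, fun w' hw' => hmin hw'⟩
  refine ⟨m / c, by positivity, fun b hb x hx i hi => ?_⟩
  set w := rowsMap A H x with hw
  have hFw : F w ≤ m * b := by
    calc F w ≤ ∑ _i : Fin m, b := by
          refine Finset.sum_le_sum fun i _ => max_le ?_ hb
          by_cases hi : i ∈ H
          · rw [hw, rowsMap_apply_of_mem hi]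
            exact hx i hi
          · rwa [hw, rowsMap_apply_of_notMem hi]
      _ = m * b := by simp
  have hwnorm : ‖w‖ ≤ m / c * b := by
    rw [div_mul_eq_mul_div, le_div_iff₀ hc]
    refine le_trans ?_ hFw
    rcases (norm_nonneg w).eq_or_lt with h0 | h0
    · rw [← h0, zero_mul]
      exact Finset.sum_nonneg fun i _ => le_max_right _ _
    · have h1 := hcF (‖w‖⁻¹ • w) ⟨by
        rw [mem_sphere_zero_iff_norm, norm_smul, norm_inv, norm_norm, inv_mul_cancel₀ h0.ne'],
        Submodule.smul_mem _ _ ⟨x, rfl⟩⟩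
      have h2 : F (‖w‖⁻¹ • w) = ‖w‖⁻¹ * F w := by
        simp only [hF, Finset.mul_sum]
        refine Finset.sum_congr rfl fun i _ => ?_
        rw [mul_max_of_nonneg _ _ (inv_nonneg.2 h0.le), mul_zero]
        rfl
      rwa [h2, ← div_eq_inv_mul, le_div_iff₀ h0, mul_comm] at h1
  rw [← rowsMap_apply_of_mem hi]
  exact (norm_le_pi_norm w i).trans hwnorm

/-- The risk level caps each prediction from above, and the hard core makes this two-sided. -/
theorem IsHardCore.exists_sublevel_bound (hH : IsHardCore A H) (hm : 0 < m) (hℓ : LossClass ℓ)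
    (r : ℝ) : ∃ R : ℝ, 0 ≤ R ∧ ∀ x : Fin n → ℝ, risk ℓ (A *ᵥ x) ≤ r →
      ∀ i ∈ H, |(A *ᵥ x) i| ≤ R := by
  obtain ⟨κ, hκ, h⟩ := hH.exists_abs_bound
  refine ⟨κ * |Function.invFun ℓ (m * r)|, by positivity, fun x hx i hi => ?_⟩
  exact h _ (abs_nonneg _) x (fun i _ => (hℓ.le_level hm hx i).trans (le_abs_self _)) i hi

/-! ### Suboptimality bounded by the gradient -/

theorem LossClass.bddBelow_risk (hℓ : LossClass ℓ) (hm : 0 < m)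
    (A : Matrix (Fin m) (Fin n) ℝ) : BddBelow (Set.range fun x : Fin n → ℝ => risk ℓ (A *ᵥ x)) :=
  ⟨0, by rintro _ ⟨x, rfl⟩; exact (hℓ.risk_pos hm _).le⟩

theorem LossClass.optRisk_le (hℓ : LossClass ℓ) (hm : 0 < m) (A : Matrix (Fin m) (Fin n) ℝ)
    (x : Fin n → ℝ) : optRisk A ℓ ≤ risk ℓ (A *ᵥ x) :=
  ciInf_le (hℓ.bddBelow_risk hm A) x

theorem LossClass.optRisk_nonneg (hℓ : LossClass ℓ) (hm : 0 < m)
    (A : Matrix (Fin m) (Fin n) ℝ) : 0 ≤ optRisk A ℓ :=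
  Real.iInf_nonneg fun _ => (hℓ.risk_pos hm _).le

/-- A uniform bound on the excess risk over competitors of no larger risk level bounds the
suboptimality. -/
theorem sub_optRisk_le {x : Fin n → ℝ} {r B : ℝ} (hx : risk ℓ (A *ᵥ x) ≤ r) (hB : 0 ≤ B)
    (h : ∀ y, risk ℓ (A *ᵥ y) ≤ r → risk ℓ (A *ᵥ x) - risk ℓ (A *ᵥ y) ≤ B) :
    risk ℓ (A *ᵥ x) - optRisk A ℓ ≤ B := by
  have : risk ℓ (A *ᵥ x) - B ≤ optRisk A ℓ := by
    refine le_ciInf fun y => ?_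
    rcases le_total (risk ℓ (A *ᵥ y)) r with hy | hy
    · linarith [h y hy]
    · linarith
  linarith

/-- On a sublevel set, the suboptimality is at most proportional to the gradient norm. -/
theorem exists_sub_optRisk_le (hm : 0 < m) (hA : ∀ i j, |A i j| ≤ 1) (hℓ : LossClass ℓ) (r : ℝ) :
    ∃ W : ℝ, 0 < W ∧ ∀ x : Fin n → ℝ, risk ℓ (A *ᵥ x) ≤ r →
      risk ℓ (A *ᵥ x) - optRisk A ℓ ≤ W * ‖colGrad A ℓ x‖ := by
  obtain ⟨H, hH⟩ := exists_isHardCore A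
  obtain ⟨u, hu, hu0⟩ := hH.exists_le_neg_one
  obtain ⟨R, hR, hbound⟩ := hH.exists_sublevel_bound hm hℓ r
  obtain ⟨κ, hκ, hpre⟩ := exists_preimage_bound A H
  set C := (lossConst ℓ (Function.invFun ℓ (m * r))).toReal with hC
  -- Off `H`, `-s • u` adds at least `s`: the part `κ * (2 * R)` absorbs `A *ᵥ μ`, and `C ^ 2` is
  -- left over.
  set s : ℝ := C ^ 2 + κ * (2 * R) with hs
  have hs0 : 0 ≤ s := by positivity
  have hW0 : 0 ≤ κ * (2 * R) + s * l1norm u :=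
    add_nonneg (by positivity) (mul_nonneg hs0 (l1norm_nonneg u))
  refine ⟨κ * (2 * R) + s * l1norm u + 1, by positivity, fun x hx => ?_⟩
  refine sub_optRisk_le hx (by positivity) fun y hy => ?_
  -- The competitor `y` may be arbitrarily large, so `x - y` is replaced by a bounded weighting with
  -- the same predictions on `H`.
  obtain ⟨μ, hμ, hμ1⟩ := hpre (x - y)
  have hdiff : ∀ i, (A *ᵥ (x - y)) i = (A *ᵥ x) i - (A *ᵥ y) i := fun i => by
    rw [Matrix.mulVec_sub]; rfl
  have hμ2 : l1norm μ ≤ κ * (2 * R) := hμ1 _ (by positivity) fun i hi => by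
    rw [hdiff]
    linarith [abs_sub ((A *ᵥ x) i) ((A *ᵥ y) i), hbound x hx i hi, hbound y hy i hi]
  have hval : ∀ i, (A *ᵥ (μ + (-s) • u)) i = (A *ᵥ μ) i - s * (A *ᵥ u) i := fun i => by
    rw [Matrix.mulVec_add, Matrix.mulVec_smul, Pi.add_apply, Pi.smul_apply, smul_eq_mul]
    ring
  calc risk ℓ (A *ᵥ x) - risk ℓ (A *ᵥ y)
      ≤ riskGrad ℓ (A *ᵥ x) ⬝ᵥ (A *ᵥ (μ + (-s) • u)) := by
        rw [hℓ.riskGrad_dotProduct, risk, risk, ← mul_sub, ← Finset.sum_sub_distrib]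
        refine mul_le_mul_of_nonneg_left (Finset.sum_le_sum fun i _ => ?_) (by positivity)
        have hd := hℓ.deriv_pos ((A *ᵥ x) i)
        rw [hval]
        by_cases hi : i ∈ H
        · rw [hu0 i hi, hμ i hi, hdiff]
          have := hℓ.add_mul_le ((A *ᵥ x) i) ((A *ᵥ y) i)
          linarith
        -- Off `H` the competitor's loss is only known to be nonnegative; the whole loss at `x` is
        -- paid for by the slope times `C ^ 2`.
        · have h1 : ℓ ((A *ᵥ x) i) ≤ C ^ 2 * deriv ℓ ((A *ᵥ x) i) :=
            hℓ.le_deriv (hℓ.le_level hm hx i)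
          have h2 := hℓ.nonneg ((A *ᵥ y) i)
          have h3 : C ^ 2 ≤ (A *ᵥ μ) i - s * (A *ᵥ u) i := by
            have h4 := (abs_le.1 (abs_mulVec_le_l1norm hA μ i)).1
            have h5 := mul_le_mul_of_nonneg_left (hu i hi) hs0
            linarith
          have h6 := mul_le_mul_of_nonneg_left h3 hd.le
          linarith
    _ = colGrad A ℓ x ⬝ᵥ (μ + (-s) • u) := dotProduct_mulVec_eq_colGrad A x _
    _ ≤ ‖colGrad A ℓ x‖ * l1norm (μ + (-s) • u) :=
        (le_abs_self _).trans (abs_dotProduct_le _ _)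
    _ ≤ ‖colGrad A ℓ x‖ * (κ * (2 * R) + s * l1norm u + 1) := by
        refine mul_le_mul_of_nonneg_left ?_ (norm_nonneg _)
        have := l1norm_add_smul_le μ u (-s)
        rw [abs_neg, abs_of_nonneg hs0] at this
        linarith
    _ = _ := mul_comm _ _

/-- If some weighting is strictly correct on all rows, the gradient norm dominates the risk. -/
theorem exists_risk_le_of_isHardCore_empty (hm : 0 < m) (hℓ : LossClass ℓ)
    (hH : IsHardCore A ∅) (r : ℝ) :
    ∃ W : ℝ, 0 < W ∧ ∀ x : Fin n → ℝ, risk ℓ (A *ᵥ x) ≤ r →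
      risk ℓ (A *ᵥ x) ≤ W * ‖colGrad A ℓ x‖ := by
  obtain ⟨u, hu, -⟩ := hH.exists_le_neg_one
  set C := (lossConst ℓ (Function.invFun ℓ (m * r))).toReal with hC
  have hu0 := l1norm_nonneg u
  refine ⟨C ^ 2 * l1norm u + 1, by positivity, fun x hx => ?_⟩
  have h1 : l1norm (riskGrad ℓ (A *ᵥ x)) ≤ riskGrad ℓ (A *ᵥ x) ⬝ᵥ (A *ᵥ -u) := by
    rw [hℓ.l1norm_riskGrad, hℓ.riskGrad_dotProduct]
    refine mul_le_mul_of_nonneg_left (Finset.sum_le_sum fun i _ => ?_) (by positivity)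
    rw [Matrix.mulVec_neg, Pi.neg_apply]
    exact le_mul_of_one_le_right (hℓ.deriv_pos _).le
      (by linarith [hu i (Finset.notMem_empty i)])
  have h2 : l1norm (-u) = l1norm u := by simp [l1norm]
  rw [dotProduct_mulVec_eq_colGrad] at h1
  have h3 := h1.trans ((le_abs_self _).trans (abs_dotProduct_le _ _))
  rw [h2] at h3
  have h4 := mul_le_mul_of_nonneg_left h3 (sq_nonneg C)
  have h5 := hℓ.risk_le_l1norm hm hx
  have h6 := norm_nonneg (colGrad A ℓ x)
  nlinarith

theorem LossClass.exists_strongly_convex (hℓ : LossClass ℓ) (R : ℝ) :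
    ∃ μ : ℝ, 0 < μ ∧ ∀ x y : ℝ, |x| ≤ R → |y| ≤ R →
      ℓ x + deriv ℓ x * (y - x) + μ * (y - x) ^ 2 ≤ ℓ y := by
  obtain ⟨hc, hE⟩ := hℓ.expLike R
  set c := (lossConst ℓ R).toReal
  have hlow : ∀ z, |z| ≤ R → Real.exp (-R) / c ≤ deriv (deriv ℓ) z := fun z hz => by
    obtain ⟨h1, h2⟩ := abs_le.1 hz
    have h3 := (hE z h2 2 (by simp)).2.2
    rw [iteratedDeriv_two] at h3
    rw [div_le_iff₀' (by linarith)]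
    exact (Real.exp_le_exp.2 h1).trans h3
  refine ⟨Real.exp (-R) / c / 2, by positivity, fun x y hx hy => ?_⟩
  have hlin : ∀ a : ℝ, HasDerivAt (fun a : ℝ => x + a * (y - x)) (y - x) a := fun a => by
    simpa using ((hasDerivAt_id a).mul_const (y - x)).const_add x
  -- Negating the loss along the segment turns the lower bound on `ℓ''` into the hypothesis of the
  -- quadratic upper bound.
  have h1 : ∀ a : ℝ, HasDerivAt (fun a : ℝ => -ℓ (x + a * (y - x)))
      (-(deriv ℓ (x + a * (y - x)) * (y - x))) a :=
    fun a => ((hℓ.hasDerivAt _).comp a (hlin a)).neg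
  have h2 : ∀ a : ℝ, HasDerivAt (fun a : ℝ => -(deriv ℓ (x + a * (y - x)) * (y - x)))
      (-(deriv (deriv ℓ) (x + a * (y - x)) * (y - x) * (y - x))) a :=
    fun a => (((hℓ.hasDerivAt_deriv _).comp a (hlin a)).mul_const _).neg
  have h3 := (le_quadratic_of_deriv2_le h1 h2 zero_le_one
    (M := -(Real.exp (-R) / c * (y - x) ^ 2)) fun a ha0 ha1 => ?_).2
  · simp only [zero_mul, add_zero, one_mul, add_sub_cancel] at h3
    linarith
  · have hz : |x + a * (y - x)| ≤ R := by
      rw [abs_le] at hx hy ⊢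
      constructor <;> nlinarith
    have := mul_le_mul_of_nonneg_right (hlow _ hz) (sq_nonneg (y - x))
    linarith

/-- If all rows form a hard core, the squared gradient norm dominates the suboptimality. -/
theorem exists_sub_optRisk_le_sq_of_isHardCore_univ (hm : 0 < m) (hℓ : LossClass ℓ)
    (hH : IsHardCore A Finset.univ) (r : ℝ) :
    ∃ W : ℝ, 0 < W ∧ ∀ x : Fin n → ℝ, risk ℓ (A *ᵥ x) ≤ r →
      risk ℓ (A *ᵥ x) - optRisk A ℓ ≤ W * ‖colGrad A ℓ x‖ ^ 2 := by
  obtain ⟨R, hR, hbound⟩ := hH.exists_sublevel_bound hm hℓ r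
  obtain ⟨κ, hκ, hpre⟩ := exists_preimage_bound A Finset.univ
  obtain ⟨μ, hμ, hstrong⟩ := hℓ.exists_strongly_convex R
  refine ⟨m * κ ^ 2 / (4 * μ) + 1, by positivity, fun x hx => ?_⟩
  refine sub_optRisk_le hx (by positivity) fun y hy => ?_
  obtain ⟨w, hw, hw1⟩ := hpre (x - y)
  set G := ‖colGrad A ℓ x‖ with hG
  set d := ‖A *ᵥ (x - y)‖ with hd
  have hdiff : ∀ i, (A *ᵥ (x - y)) i = (A *ᵥ x) i - (A *ᵥ y) i := fun i => by
    rw [Matrix.mulVec_sub]; rfl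
  have hwd : l1norm w ≤ κ * d := hw1 d (norm_nonneg _) fun i _ =>
    norm_le_pi_norm (A *ᵥ (x - y)) i
  have hAw : A *ᵥ (x - y) = A *ᵥ w := funext fun i => (hw i (Finset.mem_univ i)).symm
  have h1 : riskGrad ℓ (A *ᵥ x) ⬝ᵥ (A *ᵥ (x - y)) ≤ G * (κ * d) := by
    rw [hAw, dotProduct_mulVec_eq_colGrad]
    exact (le_abs_self _).trans ((abs_dotProduct_le _ _).trans
      (mul_le_mul_of_nonneg_left hwd (norm_nonneg _)))
  have h2 : d ^ 2 ≤ ∑ i, (A *ᵥ (x - y)) i ^ 2 := by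
    refine (Real.le_sqrt (norm_nonneg _) (Finset.sum_nonneg fun i _ => sq_nonneg _)).1 ?_
    refine (pi_norm_le_iff_of_nonneg (Real.sqrt_nonneg _)).2 fun i => Real.abs_le_sqrt ?_
    exact Finset.single_le_sum (f := fun i => (A *ᵥ (x - y)) i ^ 2)
      (fun i _ => sq_nonneg _) (Finset.mem_univ i)
  have h3 : risk ℓ (A *ᵥ x) - risk ℓ (A *ᵥ y) ≤ riskGrad ℓ (A *ᵥ x) ⬝ᵥ (A *ᵥ (x - y)) -
      (m : ℝ)⁻¹ * (μ * ∑ i, (A *ᵥ (x - y)) i ^ 2) := by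
    rw [hℓ.riskGrad_dotProduct, risk, risk, ← mul_sub, ← mul_sub, Finset.mul_sum,
      ← Finset.sum_sub_distrib, ← Finset.sum_sub_distrib]
    refine mul_le_mul_of_nonneg_left (Finset.sum_le_sum fun i _ => ?_) (by positivity)
    have := hstrong _ _ (hbound x hx i (Finset.mem_univ i)) (hbound y hy i (Finset.mem_univ i))
    rw [hdiff]
    linarith
  have hm' : (0 : ℝ) < m := by exact_mod_cast hm
  have h4 : (m : ℝ)⁻¹ * (μ * d ^ 2) ≤ (m : ℝ)⁻¹ * (μ * ∑ i, (A *ᵥ (x - y)) i ^ 2) := by gcongr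
  -- The maximum over `d` of a concave quadratic, by completing the square.
  have h5 : G * (κ * d) - (m : ℝ)⁻¹ * (μ * d ^ 2) ≤ m * κ ^ 2 / (4 * μ) * G ^ 2 := by
    have : m * κ ^ 2 / (4 * μ) * G ^ 2 - (G * (κ * d) - (m : ℝ)⁻¹ * (μ * d ^ 2)) =
        (m * κ * G - 2 * μ * d) ^ 2 / (4 * μ * m) := by
      field_simp
      ring
    have h6 : 0 ≤ (m * κ * G - 2 * μ * d) ^ 2 / (4 * μ * m) := by positivity
    linarith
  linarith [sq_nonneg G]

theorem isHardCore_empty_of_bestMargin_pos (h : 0 < bestMargin A) : IsHardCore A ∅ := by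
  obtain ⟨x, hx, hpos⟩ : ∃ x : Fin n → ℝ, l1norm x = 1 ∧ 0 < margin A x := by
    by_contra! hcon
    refine absurd h (not_lt.2 (Real.sSup_nonpos ?_))
    rintro _ ⟨x, hx, rfl⟩
    exact hcon x hx
  refine ⟨⟨x, fun i _ => ?_, fun i hi => absurd hi (Finset.notMem_empty i)⟩, ?_⟩
  · have h1 : margin A x ≤ -(A *ᵥ x) i / l1norm x := ciInf_le (Set.finite_range _).bddBelow i
    rw [hx, div_one] at h1
    linarith
  · rintro x ⟨i, hi, -⟩
    exact absurd hi (Finset.notMem_empty i)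

/-- If a row lay outside `H`, adding `u` to a minimizer would lower that row's loss and raise none.
-/
theorem IsHardCore.eq_univ_of_attained (hH : IsHardCore A H) (hm : 0 < m) (hℓ : LossClass ℓ)
    (h : ∃ y : Fin n → ℝ, ∀ z : Fin n → ℝ, risk ℓ (A *ᵥ y) ≤ risk ℓ (A *ᵥ z)) :
    H = Finset.univ := by
  obtain ⟨y, hy⟩ := h
  obtain ⟨⟨u, hu, hu0⟩, -⟩ := hH
  refine Finset.eq_univ_iff_forall.2 fun i => ?_
  by_contra hi
  have hm' : (0 : ℝ) < m := by exact_mod_cast hm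
  refine absurd (hy (y + u)) (not_le.2 (mul_lt_mul_of_pos_left ?_ (inv_pos.2 hm')))
  rw [Matrix.mulVec_add]
  refine Finset.sum_lt_sum (fun k _ => hℓ.strictMono.monotone ?_)
    ⟨i, Finset.mem_univ i, hℓ.strictMono ?_⟩
  · rw [Pi.add_apply]
    by_cases hk : k ∈ H
    · rw [hu0 k hk, add_zero]
    · linarith [hu k hk]
  · rw [Pi.add_apply]
    linarith [hu i hi]

end HardCore

/-! ### From recursions to rates -/

section Rates

variable {m n : ℕ} {ℓ : ℝ → ℝ} {A : Matrix (Fin m) (Fin n) ℝ}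

theorem mul_le_one_of_le_sub_sq {δ : ℕ → ℝ} {c : ℝ} (hc : 0 < c) (h0 : ∀ t, 0 ≤ δ t)
    (h : ∀ t, δ (t + 1) ≤ δ t - c * δ t ^ 2) (t : ℕ) : c * δ t * (t + 1) ≤ 1 := by
  -- Otherwise the next term would be negative.
  have hle : ∀ t, c * δ t ≤ 1 := fun t => by
    by_contra! hlt
    have hpos : 0 < δ t := (h0 t).lt_of_ne (by rintro he; rw [← he] at hlt; norm_num at hlt)
    nlinarith [h t, h0 (t + 1)]
  induction t with
  | zero => simpa using hle 0
  | succ t ih =>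
    have h1 : c * δ (t + 1) ≤ c * δ t * (1 - c * δ t) := by nlinarith [h t]
    set y := c * δ t with hy
    have hy0 : 0 ≤ y := mul_nonneg hc.le (h0 t)
    have hy1 : y ≤ 1 := hle t
    have ht : (0 : ℝ) ≤ t := t.cast_nonneg
    push_cast
    calc c * δ (t + 1) * (t + 1 + 1) ≤ y * (1 - y) * (t + 1 + 1) := by gcongr
      -- Expanding `(1 - y) * (1 - y * (t + 1)) ≥ 0` gives the bound up to a term `-y²`.
      _ ≤ 1 := by nlinarith [mul_nonneg (sub_nonneg.2 hy1) (sub_nonneg.2 ih)]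

theorem le_mul_exp_of_le_sub {δ : ℕ → ℝ} {q : ℝ} (h0 : ∀ t, 0 ≤ δ t)
    (h : ∀ t, δ (t + 1) ≤ δ t - q * δ t) (t : ℕ) : δ t ≤ δ 0 * Real.exp (-(q * t)) := by
  induction t with
  | zero => simp
  | succ t ih =>
    calc δ (t + 1) ≤ δ t * (-q + 1) := by linarith [h t]
      _ ≤ δ t * Real.exp (-q) := mul_le_mul_of_nonneg_left (Real.add_one_le_exp _) (h0 t)
      _ ≤ δ 0 * Real.exp (-(q * t)) * Real.exp (-q) := by gcongr
      _ = δ 0 * Real.exp (-(q * (t + 1 : ℕ))) := by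
        rw [mul_assoc, ← Real.exp_add]
        push_cast
        ring_nf

/-- Along every run the risk stays below its initial value and decreases by a multiple of the
squared gradient norm divided by the risk. -/
theorem exists_run_decrease (hm : 0 < m) (hA : ∀ i j, |A i j| ≤ 1) {ν : ℝ} (hν0 : 0 < ν)
    (hν1 : ν ≤ 1) (hℓ : LossClass ℓ) :
    ∃ c : ℝ, 0 < c ∧ ∀ rule : StepRule,
      (rule = .adaBoost → ℓ = Real.exp ∧ ∀ i j, A i j = -1 ∨ A i j = 1) →
      ∀ (x v : ℕ → Fin n → ℝ) (α : ℕ → ℝ), IsBoostRun A ℓ ν rule x v α → ∀ t,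
        risk ℓ (A *ᵥ x t) ≤ risk ℓ (A *ᵥ 0) ∧
        risk ℓ (A *ᵥ x (t + 1)) ≤
          risk ℓ (A *ᵥ x t) - c * (‖colGrad A ℓ (x t)‖ ^ 2 / risk ℓ (A *ᵥ x t)) := by
  set r := risk ℓ (A *ᵥ (0 : Fin n → ℝ)) with hr
  set C := (lossConst ℓ (Function.invFun ℓ (m * r))).toReal with hC
  have hC1 : 1 ≤ C := (hℓ.expLike _).1
  -- Four powers of `C` bound the curvature constant and two replace the ℓ¹ gradient norm by the
  -- risk.
  refine ⟨ν / (8 * C ^ 6), by positivity, fun rule hrule x v α hrun => ?_⟩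
  have hdec : ∀ t, risk ℓ (A *ᵥ x t) ≤ r → risk ℓ (A *ᵥ x (t + 1)) ≤
      risk ℓ (A *ᵥ x t) - ν / (8 * C ^ 6) *
        (‖colGrad A ℓ (x t)‖ ^ 2 / risk ℓ (A *ᵥ x t)) := fun t ht => by
    have h1 := sufficient_decrease hm hA hν0 hν1 hℓ hrule (hrun.direction t) (hrun.stepSize t)
    rw [← hrun.update] at h1
    refine h1.trans (sub_le_sub_left ?_ _)
    have hf := hℓ.risk_pos hm (A *ᵥ x t)
    have hs1 : 1 ≤ stepConst A ℓ (x t) := (hℓ.expLike _).1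
    have hlevel : Function.invFun ℓ (m * risk ℓ (A *ᵥ x t)) ≤ Function.invFun ℓ (m * r) := by
      have hm' : (0 : ℝ) < m := by exact_mod_cast hm
      refine hℓ.le_invFun ?_
      rw [hℓ.apply_invFun (by positivity)]
      gcongr
    have hsC : stepConst A ℓ (x t) ≤ C :=
      ENNReal.toReal_mono (hℓ.lossConst_lt_top _).ne (lossConst_mono hlevel)
    have hg := hℓ.l1norm_riskGrad_pos hm (A *ᵥ x t)
    have hgf := hℓ.l1norm_le_risk hm ht
    calc ν / (8 * C ^ 6) * (‖colGrad A ℓ (x t)‖ ^ 2 / risk ℓ (A *ᵥ x t))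
        = ν * ‖colGrad A ℓ (x t)‖ ^ 2 / (8 * (C ^ 4 * (C ^ 2 * risk ℓ (A *ᵥ x t)))) := by
          field_simp
      _ ≤ _ := by gcongr
  have hle : ∀ t, risk ℓ (A *ᵥ x t) ≤ r := fun t => by
    induction t with
    | zero => rw [hrun.init]
    | succ t ih =>
      refine (hdec t ih).trans ((sub_le_self _ ?_).trans ih)
      have := hℓ.risk_pos hm (A *ᵥ x t)
      positivity
  exact fun t => ⟨hle t, hdec t (hle t)⟩

end Rates

end Boosting

/-! ### Assembly of both rates -/

theorem mainTheorem7 {m n : ℕ} (hm : 0 < m) (hn : 0 < n)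
    (A : Matrix (Fin m) (Fin n) ℝ) (hA : ∀ i j, |A i j| ≤ 1)
    (ν : ℝ) (hν0 : 0 < ν) (hν1 : ν ≤ 1)
    (ℓ : ℝ → ℝ) (hℓ : Boosting.LossClass ℓ) :
    (∃ K : ℝ, 0 < K ∧
      ∀ (rule : Boosting.StepRule),
        (rule = Boosting.StepRule.adaBoost →
          ℓ = Real.exp ∧ ∀ i j, A i j = -1 ∨ A i j = 1) →
        ∀ (x v : ℕ → Fin n → ℝ) (α : ℕ → ℝ), Boosting.IsBoostRun A ℓ ν rule x v α →
          ∀ ε : ℝ, 0 < ε → ∀ t : ℕ, K * (1 / ε) ≤ t →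
            Boosting.risk ℓ (A *ᵥ x t) - Boosting.optRisk A ℓ ≤ ε) ∧
    ((0 < Boosting.bestMargin A ∨
        (∃ y : Fin n → ℝ, ∀ z : Fin n → ℝ,
          Boosting.risk ℓ (A *ᵥ y) ≤ Boosting.risk ℓ (A *ᵥ z)) ∨
        (∃ H : Finset (Fin m), Boosting.IsHardCore A H ∧ H.card = m)) →
      ∃ K : ℝ, 0 < K ∧
        ∀ (rule : Boosting.StepRule),
          (rule = Boosting.StepRule.adaBoost →
            ℓ = Real.exp ∧ ∀ i j, A i j = -1 ∨ A i j = 1) →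
          ∀ (x v : ℕ → Fin n → ℝ) (α : ℕ → ℝ), Boosting.IsBoostRun A ℓ ν rule x v α →
            ∀ ε : ℝ, 0 < ε → ∀ t : ℕ, K * max 1 (Real.log (1 / ε)) ≤ t →
              Boosting.risk ℓ (A *ᵥ x t) - Boosting.optRisk A ℓ ≤ ε) := by
  obtain ⟨c, hc, hrun⟩ := Boosting.exists_run_decrease (n := n) hm hA hν0 hν1 hℓ
  set r := Boosting.risk ℓ (A *ᵥ (0 : Fin n → ℝ)) with hr
  have hr0 : 0 < r := hℓ.risk_pos hm _
  have hopt := hℓ.optRisk_le hm A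
  have hopt0 := hℓ.optRisk_nonneg hm A
  constructor
  · obtain ⟨W, hW, hgrad⟩ := Boosting.exists_sub_optRisk_le (A := A) hm hA hℓ r
    refine ⟨W ^ 2 * r / c, by positivity, fun rule hrule x v α hx ε hε t ht => ?_⟩
    have hrate := Boosting.mul_le_one_of_le_sub_sq (c := c / (W ^ 2 * r))
      (δ := fun t => Boosting.risk ℓ (A *ᵥ x t) - Boosting.optRisk A ℓ) (by positivity)
      (fun t => sub_nonneg.2 (hopt (x t))) (fun t => ?_) t
    · have hδ := sub_nonneg.2 (hopt (x t))
      set δ := Boosting.risk ℓ (A *ᵥ x t) - Boosting.optRisk A ℓ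
      have h1 : c / (W ^ 2 * r) * δ * (W ^ 2 * r / c * (1 / ε)) ≤ 1 :=
        (mul_le_mul_of_nonneg_left (ht.trans (by linarith)) (by positivity)).trans hrate
      have h2 : c / (W ^ 2 * r) * δ * (W ^ 2 * r / c * (1 / ε)) = δ / ε := by field_simp
      rwa [h2, div_le_one hε] at h1
    · obtain ⟨hle, hdec⟩ := hrun rule hrule x v α hx t
      have hf := hℓ.risk_pos hm (A *ᵥ x t)
      have hδ := sub_nonneg.2 (hopt (x t))
      have hg := hgrad (x t) hle
      have h1 : c / (W ^ 2 * r) * (Boosting.risk ℓ (A *ᵥ x t) - Boosting.optRisk A ℓ) ^ 2 ≤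
          c * (‖Boosting.colGrad A ℓ (x t)‖ ^ 2 / Boosting.risk ℓ (A *ᵥ x t)) := by
        calc _ ≤ c / (W ^ 2 * r) * (W * ‖Boosting.colGrad A ℓ (x t)‖) ^ 2 := by gcongr
          _ = c * (‖Boosting.colGrad A ℓ (x t)‖ ^ 2 / r) := by field_simp
          _ ≤ _ := by gcongr
      linarith
  · intro hcases
    obtain ⟨q, hq, hgrad⟩ : ∃ q : ℝ, 0 < q ∧ ∀ x : Fin n → ℝ, Boosting.risk ℓ (A *ᵥ x) ≤ r →
        q * (Boosting.risk ℓ (A *ᵥ x) - Boosting.optRisk A ℓ) * Boosting.risk ℓ (A *ᵥ x) ≤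
          ‖Boosting.colGrad A ℓ x‖ ^ 2 := by
      have huniv : Boosting.IsHardCore A Finset.univ → ∃ q : ℝ, 0 < q ∧
          ∀ x : Fin n → ℝ, Boosting.risk ℓ (A *ᵥ x) ≤ r →
            q * (Boosting.risk ℓ (A *ᵥ x) - Boosting.optRisk A ℓ) * Boosting.risk ℓ (A *ᵥ x) ≤
              ‖Boosting.colGrad A ℓ x‖ ^ 2 := fun hH => by
        obtain ⟨W, hW, hgrad⟩ :=
          Boosting.exists_sub_optRisk_le_sq_of_isHardCore_univ hm hℓ hH r
        refine ⟨1 / (W * r), by positivity, fun x hx => ?_⟩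
        have hδ := sub_nonneg.2 (hopt x)
        calc _ ≤ 1 / (W * r) * (W * ‖Boosting.colGrad A ℓ x‖ ^ 2) * r := by
              have := hgrad x hx
              have := hℓ.risk_pos hm (A *ᵥ x)
              gcongr
          _ = _ := by field_simp
      rcases hcases with h | h | ⟨H, hH, hcard⟩
      · obtain ⟨W, hW, hgrad⟩ := Boosting.exists_risk_le_of_isHardCore_empty hm hℓ
          (Boosting.isHardCore_empty_of_bestMargin_pos h) r
        refine ⟨1 / W ^ 2, by positivity, fun x hx => ?_⟩
        have hf := hℓ.risk_pos hm (A *ᵥ x)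
        calc _ ≤ 1 / W ^ 2 * (W * ‖Boosting.colGrad A ℓ x‖) * (W * ‖Boosting.colGrad A ℓ x‖) := by
              have h1 := hgrad x hx
              gcongr
              linarith
          _ = _ := by field_simp
      · obtain ⟨H, hH⟩ := Boosting.exists_isHardCore A
        exact huniv (hH.eq_univ_of_attained hm hℓ h ▸ hH)
      · exact huniv (Finset.eq_univ_of_card H (by simpa using hcard) ▸ hH)
    -- The term `|log r|` absorbs the initial suboptimality, at most `r`; the maximum with `1` lets
    -- it be multiplied through.
    refine ⟨(|Real.log r| + 1) / (c * q), by positivity,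
      fun rule hrule x v α hx ε hε t ht => ?_⟩
    have hrate := Boosting.le_mul_exp_of_le_sub (q := c * q)
      (δ := fun t => Boosting.risk ℓ (A *ᵥ x t) - Boosting.optRisk A ℓ)
      (fun t => sub_nonneg.2 (hopt (x t))) (fun t => ?_) t
    · refine hrate.trans ?_
      have h1 : Boosting.risk ℓ (A *ᵥ x 0) - Boosting.optRisk A ℓ ≤ Real.exp |Real.log r| := by
        rw [hx.init]
        calc _ ≤ r := by linarith
          _ = Real.exp (Real.log r) := (Real.exp_log hr0).symm
          _ ≤ _ := Real.exp_le_exp.2 (le_abs_self _)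
      have h2 : |Real.log r| + Real.log (1 / ε) ≤ c * q * t := by
        have h3 : (|Real.log r| + 1) * max 1 (Real.log (1 / ε)) ≤ c * q * t := by
          rw [div_mul_eq_mul_div, div_le_iff₀ (by positivity)] at ht
          linarith
        have h4 := mul_le_mul_of_nonneg_left (le_max_left 1 (Real.log (1 / ε)))
          (abs_nonneg (Real.log r))
        linarith [le_max_right 1 (Real.log (1 / ε))]
      calc _ ≤ Real.exp |Real.log r| * Real.exp (-(c * q * t)) := by gcongr
        _ = Real.exp (|Real.log r| - c * q * t) := by rw [← Real.exp_add]; rfl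
        _ ≤ Real.exp (-Real.log (1 / ε)) := Real.exp_le_exp.2 (by linarith)
        _ = ε := by rw [one_div, Real.log_inv, neg_neg, Real.exp_log hε]
    · obtain ⟨hle, hdec⟩ := hrun rule hrule x v α hx t
      have hf := hℓ.risk_pos hm (A *ᵥ x t)
      have hg := hgrad (x t) hle
      rw [← le_div_iff₀ hf] at hg
      have := mul_le_mul_of_nonneg_left hg hc.le
      linarith
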